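/- **Setting.** Let $\mathcal S,\mathcal A$ be finite. Fix $\gamma\in[0,1)$, $d_0\in\Delta(\mathcal S)$, a reward kernel $R$ giving each $(s,a)$ a probability distribution on $[0,R_{\max}]$, a policy $\pi:\mathcal S\to\Delta(\mathcal A)$, transition functions $P_{te}$ (real environment) and $P_{tr}$ (simulator), and a data distribution $\mu\in\Delta(\mathcal S\times\mathcal A)$ with $\mu(s,a)>0$ for all $(s,a)$. For $P\in\{P_{te},P_{tr}\}$ put $d^\pi_P(s,a)=(1-\gamma)\sum_{t\ge0}\gamma^t\,\mathbb P[s_t=s,a_t=a\mid\pi,d_0,P]$, $J(\pi)=\mathbb E_{(s,a)\sim d^\pi_{P_{te}},\,r\sim R(s,a)}[r]$, $f(s,\pi)=\mathbb E_{a\sim\pi(\cdot|s)}[f(s,a)]$, $\beta=d^\pi_{P_{tr}}/\mu$, $w^\pi_{P_{te}/P_{tr}}=d^\pi_{P_{te}}/d^\pi_{P_{tr}}$, $\|\beta\|_\infty=\max_{s,a}\beta(s,a)$ and $$L_q(w,b,q)=\Big|\mathbb E_{(s,a)\sim\mu,\,s'\sim P_{te}(\cdot|s,a)}\big[w(s,a)\,b(s,a)\,(q(s,a)-\gamma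 q(s',\pi))\big]-\mathbb E_{(s,a)\sim d^\pi_{P_{tr}},\,r\sim R(s,a)}[w(s,a)\,r]\Big| .$$ **Assumptions.** Let $\mathcal F,\mathcal W,\mathcal Q$ be classes of functions $\mathcal S\times\mathcal A\to\mathbb R$ with $0<C_{\mathcal F,\min}\le f\le C_{\mathcal F,\max}$ for $f\in\mathcal F$, $0\le w\le C_{\mathcal W}$ for $w\in\mathcal W$, and $0\le q\le C_{\mathcal Q}$ for $q\in\mathcal Q$, where $C_{\mathcal Q}\le R_{\max}/(1-\gamma)$. Put $C_{\mathcal F}=C_{\mathcal F,\max}+\max(\log C_{\mathcal F,\max},-\log C_{\mathcal F,\min})$. Assume $\beta\in\mathcal F$ and $w^\pi_{P_{te}/P_{tr}}\in\operatorname{conv}(\mathcal W)$. **Estimators.** Let $n\ge1$. From $n$ i.i.d. pairs $(x_i,y_i)\sim\mu\otimes d^\pi_{P_{tr}}$ let $$\hat\beta\in\arg\max_{f\in\mathcal F}\ \frac1n\sum_i\log f(y_i)-\frac1n\sum_i f(x_i).$$ From $n$ i.i.d. pairs of a transition $(s_i,a_i,s'_i)$, $(s_i,a_i)\sim\mu$,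 $s_i'\sim P_{te}(\cdot|s_i,a_i)$, and an independent simulator sample $(\tilde s_i,\tilde a_i,\tilde r_i)$, $(\tilde s_i,\tilde a_i)\sim d^\pi_{P_{tr}}$, $\tilde r_i\sim R(\tilde s_i,\tilde a_i)$, let $\hat q_n\in\arg\min_{q\in\mathcal Q}\sup_{w\in\mathcal W}L_{n,q}(w,\hat\beta,q)$, where $L_{n,q}$ is $L_q$ with both expectations replaced by sample averages. The two samples may be the same, independent, or dependent in any other way. **Theorem.** There is a universal constant $c>0$ such that in every such setting, for every $\delta\in(0,1)$, with probability at least $1-\delta$, $$\begin{aligned}\big|(1-\gamma)\,\mathbb E_{s\sim d_0}[\hat q_n(s,\pi)]-J(\pi)\big|\le{}&\inf_{q\in\mathcal Q}\sup_{w\in\mathcal W}L_q(w,\beta,q)+4\,\mathcal R_n(\mathcal W,\mathcal Q)+2C_{\mathcal W}\frac{R_{\max}}{1-\gamma}\sqrt{\frac{\log(2/\delta)}{2n}}\\&+C_{\mathcal W}\frac{R_{\max}}{1-\gamma}\cdot c\,\sqrt{K\,\|\beta\|_\infty\Big(4\,\mathbb E\mathcal R_n(\mathcal F)+C_{\mathcal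 F}\sqrt{\frac{2\log(2/\delta)}{n}}\Big)},\end{aligned}$$ where $K=\max_{s,a}1/\mu(s,a)$. Here $\mathcal R_n$ of a function class $\mathcal G$ at points $z_1,\dots,z_n$ is $\mathbb E_\sigma\sup_{g\in\mathcal G}\frac1n\sum_i\sigma_i g(z_i)$ with independent uniform signs $\sigma_i$; $\mathbb E\mathcal R_n(\mathcal F)$ is its expectation for the class $\{(x,y)\mapsto f(x)-\log f(y):f\in\mathcal F\}$ on the pairs $(x_i,y_i)$; and $\mathcal R_n(\mathcal W,\mathcal Q)$ is that of $\{(s,a,s')\mapsto w(s,a)\beta(s,a)(q(s,a)-\gamma q(s',\pi)):w\in\mathcal W,q\in\mathcal Q\}$ on the transitions. On the same event the bound holds both with the empirical $\mathcal R_n(\mathcal W,\mathcal Q)$ and with its expectation. -/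

import Mathlib

open MeasureTheory ProbabilityTheory

namespace OffEnv

noncomputable section

/-- The data shared by the target environment and the simulator: discount factor, initial state
distribution and a random reward in `[0, Rmax]`. The dynamics `S → A → PMF S` is kept separate,
because the target environment and the simulator have different ones. -/
structure Env (S A : Type*) where
  γ : ℝ
  γ_nonneg : 0 ≤ γ
  γ_lt_one : γ < 1
  d₀ : PMF S
  Rmax : ℝ
  R : S × A → Measure ℝ
  R_prob : ∀ x, IsProbabilityMeasure (R x)
  R_mem : ∀ x, ∀ᵐ r ∂(R x), r ∈ Set.Icc 0 Rmax

variable {S A : Type*}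

/-- Law of `s_t` when `s₀ ∼ d₀`, `a_t ∼ π(· | s_t)`, `s_{t+1} ∼ P(· | s_t, a_t)`. -/
def stateLaw (M : Env S A) (P : S → A → PMF S) (π : S → PMF A) : ℕ → PMF S
  | 0 => M.d₀
  | t + 1 => (stateLaw M P π t).bind fun s => (π s).bind fun a => P s a

/-- Law of `(s_t, a_t)`. -/
def stateActionLaw (M : Env S A) (P : S → A → PMF S) (π : S → PMF A) (t : ℕ) : PMF (S × A) :=
  (stateLaw M P π t).bind fun s => (π s).map fun a => (s, a)

/-- Discounted occupancy `d^π_P(s,a) = (1-γ) ∑_t γ^t ℙ[s_t = s, a_t = a]`. -/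
def occ (M : Env S A) (P : S → A → PMF S) (π : S → PMF A) (x : S × A) : ℝ :=
  (1 - M.γ) * ∑' t : ℕ, M.γ ^ t * (stateActionLaw M P π t x).toReal

/-- Normalized return `J_P(π) = 𝔼_{(s,a) ∼ d^π_P, r ∼ R(s,a)}[r]`. -/
def J [Fintype S] [Fintype A] (M : Env S A) (P : S → A → PMF S) (π : S → PMF A) : ℝ :=
  ∑ x : S × A, occ M P π x * ∫ r, r ∂(M.R x)

/-- `f(s, π) = 𝔼_{a ∼ π(·|s)}[f(s,a)]`. -/
def underPolicy [Fintype A] (π : S → PMF A) (f : S × A → ℝ) (s : S) : ℝ :=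
  ∑ a : A, (π s a).toReal * f (s, a)

/-- `𝔼_{s ∼ d₀}[f(s, π)]`. -/
def initialValue [Fintype S] [Fintype A] (M : Env S A) (π : S → PMF A) (f : S × A → ℝ) : ℝ :=
  ∑ s : S, (M.d₀ s).toReal * underPolicy π f s

/-- The density ratio `β = d^π_P / μ`. -/
def betaRatio (M : Env S A) (P : S → A → PMF S) (π : S → PMF A) (μ : PMF (S × A))
    (x : S × A) : ℝ :=
  occ M P π x / (μ x).toReal

/-- The density ratio `w^π_{P/P'} = d^π_P / d^π_{P'}`. -/
def weightRatio (M : Env S A) (P P' : S → A → PMF S) (π : S → PMF A) (x : S × A) : ℝ :=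
  occ M P π x / occ M P' π x

/-- Law of a logged transition `((s,a),s')`, with `(s,a) ∼ μ` and `s' ∼ P(s,a)`. -/
def transitionLaw [MeasurableSpace S] [MeasurableSpace A] (P : S → A → PMF S)
    (μ : PMF (S × A)) : Measure ((S × A) × S) :=
  (μ.bind fun x => (P x.1 x.2).map fun s' => (x, s')).toMeasure

/-- The occupancy `d^π_P` as a measure. -/
def occLaw [Fintype S] [Fintype A] [MeasurableSpace S] [MeasurableSpace A]
    (M : Env S A) (P : S → A → PMF S) (π : S → PMF A) : Measure (S × A) :=
  ∑ x : S × A, ENNReal.ofReal (occ M P π x) • Measure.dirac x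

/-- Law of `((s,a),r)` with `(s,a) ∼ d^π_P` and `r ∼ R(s,a)`. -/
def occRewardLaw [Fintype S] [Fintype A] [MeasurableSpace S] [MeasurableSpace A]
    (M : Env S A) (P : S → A → PMF S) (π : S → PMF A) : Measure ((S × A) × ℝ) :=
  ∑ x : S × A, ENNReal.ofReal (occ M P π x) • (Measure.dirac x).prod (M.R x)

/-- The integrand `w(s,a) b(s,a) (q(s,a) - γ q(s',π))`. -/
def tdTerm [Fintype A] (M : Env S A) (π : S → PMF A) (w b q : S × A → ℝ)
    (z : (S × A) × S) : ℝ :=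
  w z.1 * b z.1 * (q z.1 - M.γ * underPolicy π q z.2)

/-- Population loss
`L_q(w,b,q) = |𝔼_{(s,a) ∼ μ, s' ∼ Pte}[w b (q(s,a) - γ q(s',π))] - 𝔼_{(s,a) ∼ d^π_Ptr, r ∼ R}[w r]|`. -/
def lossQ [Fintype S] [Fintype A] [MeasurableSpace S] [MeasurableSpace A] (M : Env S A)
    (Pte Ptr : S → A → PMF S) (π : S → PMF A) (μ : PMF (S × A)) (w b q : S × A → ℝ) : ℝ :=
  |(∫ z, tdTerm M π w b q z ∂(transitionLaw Pte μ))
    - ∫ y, w y.1 * y.2 ∂(occRewardLaw M Ptr π)|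

/-- Empirical loss on `n` transitions `T` from the target environment and `n` simulator samples
`G` of state, action and reward. -/
def lossQEmp [Fintype A] (M : Env S A) (π : S → PMF A) {n : ℕ} (T : Fin n → (S × A) × S)
    (G : Fin n → (S × A) × ℝ) (w b q : S × A → ℝ) : ℝ :=
  |(n : ℝ)⁻¹ * (∑ i, tdTerm M π w b q (T i)) - (n : ℝ)⁻¹ * ∑ i, w (G i).1 * (G i).2|

/-- Empirical objective of the density ratio estimator: `X` is sampled from the denominator,
`Y` from the numerator. -/
def ratioObjective {n : ℕ} (X Y : Fin n → S × A) (f : S × A → ℝ) : ℝ :=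
  (n : ℝ)⁻¹ * (∑ i, Real.log (f (Y i))) - (n : ℝ)⁻¹ * ∑ i, f (X i)

/-- Empirical Rademacher complexity
`𝔼_σ sup_{g ∈ G} (1/n) ∑_i σ_i g(z_i)`, with independent uniform signs. -/
def empRademacher {Z : Type*} {n : ℕ} (G : Set (Z → ℝ)) (z : Fin n → Z) : ℝ :=
  ((2 : ℝ) ^ n)⁻¹ * ∑ σ : Fin n → Bool,
    ⨆ g : G, (n : ℝ)⁻¹ * ∑ i, (if σ i then (1 : ℝ) else -1) * (g : Z → ℝ) (z i)

/-- Expected Rademacher complexity, for `n` independent points of law `ν`. -/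
def expRademacher {Z : Type*} [MeasurableSpace Z] (n : ℕ) (G : Set (Z → ℝ))
    (ν : Measure Z) : ℝ :=
  ∫ z : Fin n → Z, empRademacher G z ∂(Measure.pi fun _ => ν)

/-- The class `{(x,y) ↦ f(x) - log f(y) : f ∈ F}`. -/
def ratioClass (F : Set (S × A → ℝ)) : Set ((S × A) × (S × A) → ℝ) :=
  {g | ∃ f ∈ F, g = fun p => f p.1 - Real.log (f p.2)}

/-- The class `{(s,a,s') ↦ w(s,a) b(s,a) (q(s,a) - γ q(s',π)) : w ∈ W, q ∈ Q}`. -/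
def tdClass [Fintype A] (M : Env S A) (π : S → PMF A) (b : S × A → ℝ)
    (W Q : Set (S × A → ℝ)) : Set ((S × A) × S → ℝ) :=
  {g | ∃ w ∈ W, ∃ q ∈ Q, g = tdTerm M π w b q}

/-- The constant `C_F = C_max + max (log C_max) (-log C_min)`. -/
def classConst (Cmin Cmax : ℝ) : ℝ :=
  Cmax + max (Real.log Cmax) (-Real.log Cmin)

/-- The bound on the evaluation error. The argument `rad` stands for the Rademacher complexity of
the class `tdClass`, and `c` for the numerical constant in the `β`-estimation error;
`⨆ x, (μ x)⁻¹` is the reciprocal of the smallest mass of `μ`. -/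
def errorBound [Fintype S] [Fintype A] [MeasurableSpace S] [MeasurableSpace A] (M : Env S A)
    (Pte Ptr : S → A → PMF S) (π : S → PMF A) (μ : PMF (S × A)) (F W Q : Set (S × A → ℝ))
    (CW Cmin Cmax δ : ℝ) (n : ℕ) (c rad : ℝ) : ℝ :=
  (⨅ q : Q, ⨆ w : W, lossQ M Pte Ptr π μ w (betaRatio M Ptr π μ) q)
    + 4 * rad
    + 2 * CW * (M.Rmax / (1 - M.γ)) * √(Real.log (2 / δ) / (2 * n))
    + CW * (M.Rmax / (1 - M.γ)) *
        (c * √((⨆ x, ((μ x).toReal)⁻¹) * ((⨆ x, betaRatio M Ptr π μ x) *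
          (4 * expRademacher n (ratioClass F) (μ.toMeasure.prod (occLaw M Ptr π))
            + classConst Cmin Cmax * √(2 * Real.log (2 / δ) / n)))))

end

end OffEnv

open OffEnv

namespace OffEnv

open scoped NNReal

/-! ### Concentration of functions with bounded differences -/

section Concentration

variable {E : Type*} [Finite E] [MeasurableSpace E] [MeasurableSingletonClass E]

/-! At the true ratios the population loss of `q` is exactly its evaluation error: by the Bellman
flow equation, weighting the temporal difference by `d^π_{Pte}` leaves `(1-γ) 𝔼_{d₀}[q(s,π)]`, and
weighting the reward leaves `J` (`sum_occ_mul_td`, `lossQ_weightRatio`). The loss is the absolute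
value of a linear form in `w`, so a bound over `W` passes to its convex hull. Hence if the empirical
loss with `βhat` is uniformly `ε`-close to the population loss with `β`, the minimax solution has
error at most the minimax population loss plus `2ε` (`abs_value_error_le_of_uniform`).

Two contributions make up `ε`. The first is the sup-norm error of `βhat`. The excess risk of the
ratio estimator is a generalized Kullback-Leibler divergence, which dominates `∑ μ (√β - √βhat)²`;
dividing by the smallest mass of `μ` gives a pointwise bound. The excess risk itself is controlled
by symmetrization and a McDiarmid bound (`measure_supDeviation_add_gt_le`). Since the error of
`βhat` is measured in sup norm, it enters the empirical loss by a deterministic Lipschitz estimate,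
so the dependence between the two samples plays no role.

The second is the deviation of the empirical loss at the fixed function `β`. The loss is a
combination of forms linear in `w q` and bilinear in `w` and `q(·,π)`, tested against the empirical
minus the true law. Such forms on boxes are bounded by their values at vertices, so Hoeffding's
inequality and a union bound over finitely many subsets and rectangles suffice. The logarithm of
their number is of order `|S × A|`, which is at most `K = max 1/μ`.

With `θ = K ‖β‖∞ (4 𝔼R_n(F) + C_F √(2 log(2/δ)/n))`, both contributions are at most a constant times
`C_W V √θ` when `θ < 1`, where `V = Rmax/(1-γ)`; when `θ ≥ 1` the trivial bound `Rmax` on the error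
is enough. The last term of the error bound thus carries all the statistical error. The complexity
of the temporal difference class and the explicit deviation term enter only as nonnegative
quantities, which is why the empirical and the expected complexity are served by one event. -/

theorem integral_pi_succ_eq_integral_integral_cons (ν : Measure E) [IsProbabilityMeasure ν]
    (n : ℕ) (Φ : (Fin (n + 1) → E) → ℝ) :
    ∫ z, Φ z ∂(Measure.pi fun _ => ν)
      = ∫ z, ∫ e, Φ (Fin.cons e z) ∂ν ∂(Measure.pi fun _ : Fin n => ν) := by
  rw [← ((measurePreserving_piFinSuccAbove (fun _ : Fin (n + 1) => ν) 0).symm).integral_comp',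
    integral_prod_symm _ .of_finite]
  simp_rw [MeasurableEquiv.piFinSuccAbove_symm_apply, Fin.insertNthEquiv, Equiv.coe_fn_mk,
    Fin.insertNth_zero]
  rfl

/-- McDiarmid's inequality on a finite space, as a bound on the moment generating function. -/
theorem hasSubgaussianMGF_of_bounded_differences (ν : Measure E) [IsProbabilityMeasure ν]
    (c : ℝ≥0) (n : ℕ) (Φ : (Fin n → E) → ℝ)
    (hΦ : ∀ z i e, |Φ (Function.update z i e) - Φ z| ≤ c) :
    HasSubgaussianMGF (fun z => Φ z - ∫ y, Φ y ∂(Measure.pi fun _ => ν)) (n * c ^ 2)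
      (Measure.pi fun _ => ν) := by
  induction n with
  | zero =>
    refine HasSubgaussianMGF.congr (X := fun _ => 0) (by simp) (ae_of_all _ fun z => ?_)
    have h : ∀ y, Φ y = Φ z := fun y => congrArg Φ (Subsingleton.elim y z)
    simp [h]
  | succ n ih =>
    refine ⟨fun t => .of_finite, fun t => ?_⟩
    -- Averaging out the first coordinate preserves the mean and the bounded differences, so the
    -- induction hypothesis applies to `Ψ`; the remainder `Φ - Ψ` is handled conditionally on the
    -- other coordinates.
    set Ψ : (Fin n → E) → ℝ := fun z => ∫ e, Φ (Fin.cons e z) ∂ν with hΨdef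
    have hmean : ∫ y, Φ y ∂(Measure.pi fun _ => ν) = ∫ z, Ψ z ∂(Measure.pi fun _ => ν) :=
      integral_pi_succ_eq_integral_integral_cons ν n Φ
    have hΨ : ∀ z i e, |Ψ (Function.update z i e) - Ψ z| ≤ c := by
      intro z i e
      simp only [hΨdef]
      rw [← integral_sub .of_finite .of_finite]
      have h := norm_integral_le_of_norm_le_const (μ := ν) (C := (c : ℝ))
        (f := fun e' => Φ (Fin.cons e' (Function.update z i e)) - Φ (Fin.cons e' z))
        (ae_of_all _ fun e' => by rw [Real.norm_eq_abs, Fin.cons_update]; exact hΦ _ _ _)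
      simpa using h
    have hcond : ∀ z, ∫ e, Real.exp (t * (Φ (Fin.cons e z) - Ψ z)) ∂ν
        ≤ Real.exp ((c : ℝ) ^ 2 * t ^ 2 / 2) := by
      intro z
      obtain ⟨e₀⟩ : Nonempty E := nonempty_of_isProbabilityMeasure ν
      -- An interval of length `2c` gives variance proxy `c²` in Hoeffding's lemma. Centring at an
      -- arbitrary `e₀` costs a factor 4 against the sharp constant.
      have hb : ∀ᵐ e ∂ν, Φ (Fin.cons e z) ∈
          Set.Icc (Φ (Fin.cons e₀ z) - c) (Φ (Fin.cons e₀ z) + c) := ae_of_all _ fun e => by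
        have h := abs_le.1 (hΦ (Fin.cons e₀ z) 0 e)
        rw [Fin.update_cons_zero] at h
        constructor <;> linarith [h.1, h.2]
      have h := (hasSubgaussianMGF_of_mem_Icc (X := fun e => Φ (Fin.cons e z))
        (Measurable.of_discrete).aemeasurable hb).mgf_le t
      refine h.trans_eq ?_
      have : Φ (Fin.cons e₀ z) + c - (Φ (Fin.cons e₀ z) - c) = (2 * c : ℝ) := by ring
      rw [this]
      simp
    have ihm := (ih Ψ hΨ).mgf_le t
    unfold mgf at ihm ⊢
    rw [integral_pi_succ_eq_integral_integral_cons ν n, hmean]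
    calc _ ≤ ∫ z, Real.exp (t * (Ψ z - ∫ z, Ψ z ∂(Measure.pi fun _ => ν)))
              * Real.exp ((c : ℝ) ^ 2 * t ^ 2 / 2) ∂(Measure.pi fun _ : Fin n => ν) := by
          refine integral_mono .of_finite .of_finite fun z => ?_
          refine le_trans (le_of_eq ?_) (mul_le_mul_of_nonneg_left (hcond z) (Real.exp_nonneg _))
          rw [← integral_const_mul]
          refine integral_congr_ae (ae_of_all _ fun e => ?_)
          simp only [← Real.exp_add]
          congr 1
          ring
      _ ≤ _ := by
          rw [integral_mul_const]
          refine (mul_le_mul_of_nonneg_right ihm (Real.exp_nonneg _)).trans_eq ?_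
          rw [← Real.exp_add]
          congr 1
          push_cast
          ring

end Concentration

/-! ### Rademacher complexity -/

section Rademacher

variable {Z : Type*} {n : ℕ}

/-- A pointwise bounded class has bounded signed averages at every sample. -/
theorem bddAbove_range_average {G : Set (Z → ℝ)} {C : ℝ} (hG : ∀ g ∈ G, ∀ z, |g z| ≤ C)
    (a : Fin n → ℝ) (z : Fin n → Z) :
    BddAbove (Set.range fun g : G => (n : ℝ)⁻¹ * ∑ i, a i * (g : Z → ℝ) (z i)) := by
  refine ⟨(n : ℝ)⁻¹ * ∑ i, |a i| * C, ?_⟩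
  rintro _ ⟨g, rfl⟩
  refine mul_le_mul_of_nonneg_left (Finset.sum_le_sum fun i _ => ?_) (by positivity)
  refine (le_abs_self _).trans ?_
  rw [abs_mul]
  exact mul_le_mul_of_nonneg_left (hG g g.2 _) (abs_nonneg _)

theorem sum_sign_eq_zero (i : Fin n) :
    ∑ σ : Fin n → Bool, (if σ i then (1 : ℝ) else -1) = 0 := by
  have h := Fintype.sum_equiv (Equiv.piCongrRight fun _ : Fin n => Equiv.boolNot)
    (fun σ : Fin n → Bool => (if σ i then (1 : ℝ) else -1))
    (fun σ => -(if σ i then (1 : ℝ) else -1)) (fun σ => by cases h : σ i <;> simp [h])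
  rw [Finset.sum_neg_distrib] at h
  linarith

theorem empRademacher_nonneg {G : Set (Z → ℝ)} {C : ℝ} (hG : ∀ g ∈ G, ∀ z, |g z| ≤ C)
    (hne : G.Nonempty) (z : Fin n → Z) : 0 ≤ empRademacher G z := by
  obtain ⟨g, hg⟩ := hne
  refine mul_nonneg (by positivity) ?_
  calc (0 : ℝ) = ∑ σ : Fin n → Bool, (n : ℝ)⁻¹ * ∑ i, (if σ i then (1 : ℝ) else -1) * g (z i) := by
        rw [← Finset.mul_sum, Finset.sum_comm]
        simp only [← Finset.sum_mul, sum_sign_eq_zero, zero_mul, Finset.sum_const_zero, mul_zero]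
    _ ≤ _ := Finset.sum_le_sum fun σ _ => le_ciSup (f := fun g : G =>
        (n : ℝ)⁻¹ * ∑ i, (if σ i then (1 : ℝ) else -1) * (g : Z → ℝ) (z i))
        (bddAbove_range_average hG _ z) ⟨g, hg⟩

theorem expRademacher_nonneg [MeasurableSpace Z] {G : Set (Z → ℝ)} {C : ℝ}
    (hG : ∀ g ∈ G, ∀ z, |g z| ≤ C) (hne : G.Nonempty) (ν : Measure Z) :
    0 ≤ expRademacher n G ν :=
  integral_nonneg fun z => empRademacher_nonneg hG hne z

/-- The Rademacher average is invariant under a global change of sign. -/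
theorem empRademacher_eq_neg (G : Set (Z → ℝ)) (z : Fin n → Z) :
    empRademacher G z = ((2 : ℝ) ^ n)⁻¹ * ∑ σ : Fin n → Bool,
      ⨆ g : G, (n : ℝ)⁻¹ * ∑ i, -(if σ i then (1 : ℝ) else -1) * (g : Z → ℝ) (z i) := by
  unfold empRademacher
  congr 1
  refine Fintype.sum_equiv (Equiv.piCongrRight fun _ : Fin n => Equiv.boolNot) _ _ fun σ => ?_
  congr 1
  ext g
  congr 1
  refine Finset.sum_congr rfl fun i _ => ?_
  cases h : σ i <;> simp [h]

variable {E : Type*} [Finite E] [MeasurableSpace E] [MeasurableSingletonClass E]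

/-- Exchanging the two points of a pair, at the indices where `σ` is `false`, preserves the law of
two independent samples. -/
theorem integral_pi_prod_swap (ν : Measure E) [IsProbabilityMeasure ν] (σ : Fin n → Bool)
    (H : (Fin n → E × E) → ℝ) :
    ∫ u, H u ∂(Measure.pi fun _ : Fin n => ν.prod ν)
      = ∫ u, H (fun i => if σ i then u i else (u i).swap) ∂(Measure.pi fun _ => ν.prod ν) := by
  have hmp : MeasurePreserving (fun (u : Fin n → E × E) i => (if σ i then id else Prod.swap) (u i))
      (Measure.pi fun _ => ν.prod ν) (Measure.pi fun _ => ν.prod ν) := by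
    refine measurePreserving_pi _ _ fun i => ?_
    cases σ i
    · exact Measure.measurePreserving_swap
    · exact MeasurePreserving.id _
  rw [← hmp.map_eq, integral_map hmp.measurable.aemeasurable
    (Measurable.of_discrete).aestronglyMeasurable, hmp.map_eq]
  congr 1
  ext u
  congr 1
  ext i : 1
  cases σ i <;> simp

theorem integral_pi_prod_fst (ν : Measure E) [IsProbabilityMeasure ν] (H : (Fin n → E) → ℝ) :
    ∫ u, H (fun i => (u i).1) ∂(Measure.pi fun _ : Fin n => ν.prod ν)
      = ∫ z, H z ∂(Measure.pi fun _ => ν) := by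
  have hmp : MeasurePreserving (fun (u : Fin n → E × E) i => (u i).1)
      (Measure.pi fun _ => ν.prod ν) (Measure.pi fun _ => ν) :=
    measurePreserving_pi _ _ fun i => measurePreserving_fst
  rw [← hmp.map_eq, integral_map hmp.measurable.aemeasurable
    (Measurable.of_discrete).aestronglyMeasurable]

theorem integral_pi_prod_snd (ν : Measure E) [IsProbabilityMeasure ν] (H : (Fin n → E) → ℝ) :
    ∫ u, H (fun i => (u i).2) ∂(Measure.pi fun _ : Fin n => ν.prod ν)
      = ∫ z, H z ∂(Measure.pi fun _ => ν) := by
  have hmp : MeasurePreserving (fun (u : Fin n → E × E) i => (u i).2)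
      (Measure.pi fun _ => ν.prod ν) (Measure.pi fun _ => ν) :=
    measurePreserving_pi _ _ fun i => measurePreserving_snd
  rw [← hmp.map_eq, integral_map hmp.measurable.aemeasurable
    (Measurable.of_discrete).aestronglyMeasurable]

theorem integral_pi_average (ν : Measure E) [IsProbabilityMeasure ν] (hn : 0 < n) (g : E → ℝ) :
    ∫ z, (n : ℝ)⁻¹ * ∑ i, g (z i) ∂(Measure.pi fun _ : Fin n => ν) = ∫ e, g e ∂ν := by
  have hmp : ∀ i : Fin n, ∫ z, g (z i) ∂(Measure.pi fun _ : Fin n => ν) = ∫ e, g e ∂ν := by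
    intro i
    have h := measurePreserving_eval (fun _ : Fin n => ν) i
    conv_rhs => rw [← h.map_eq, integral_map h.measurable.aemeasurable
      (Measurable.of_discrete).aestronglyMeasurable]
  rw [integral_const_mul, integral_finsetSum _ fun _ _ => .of_finite]
  simp [hmp, hn.ne']

/-- The largest excess, over the class `G`, of the mean over the sample average. -/
noncomputable def supDeviation (G : Set (E → ℝ)) (ν : Measure E) (z : Fin n → E) : ℝ :=
  ⨆ g : G, (∫ e, (g : E → ℝ) e ∂ν - (n : ℝ)⁻¹ * ∑ i, (g : E → ℝ) (z i))

theorem abs_average_le {g : Z → ℝ} {C : ℝ} (hn : 0 < n) (hg : ∀ z, |g z| ≤ C) (z : Fin n → Z) :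
    |(n : ℝ)⁻¹ * ∑ i, g (z i)| ≤ C := by
  rw [abs_mul, abs_of_nonneg (by positivity : (0 : ℝ) ≤ (n : ℝ)⁻¹)]
  have h : |∑ i, g (z i)| ≤ n * C :=
    (Finset.abs_sum_le_sum_abs _ _).trans
      ((Finset.sum_le_sum fun i _ => hg (z i)).trans_eq (by simp))
  calc (n : ℝ)⁻¹ * |∑ i, g (z i)| ≤ (n : ℝ)⁻¹ * (n * C) := by gcongr
    _ = C := by field_simp

theorem abs_integral_le_of_abs_le {Z : Type*} [MeasurableSpace Z] {ν : Measure Z}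
    [IsProbabilityMeasure ν] {g : Z → ℝ} {C : ℝ} (hg : ∀ z, |g z| ≤ C) : |∫ e, g e ∂ν| ≤ C := by
  simpa using norm_integral_le_of_norm_le_const (μ := ν) (ae_of_all _ fun z => (Real.norm_eq_abs _).trans_le (hg z))

theorem bddAbove_range_deviation {E : Type*} [MeasurableSpace E] {G : Set (E → ℝ)} {C : ℝ} (hG : ∀ g ∈ G, ∀ z, |g z| ≤ C)
    (hn : 0 < n) (ν : Measure E) [IsProbabilityMeasure ν] (z : Fin n → E) :
    BddAbove (Set.range fun g : G =>
      (∫ e, (g : E → ℝ) e ∂ν - (n : ℝ)⁻¹ * ∑ i, (g : E → ℝ) (z i))) := by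
  refine ⟨C + C, ?_⟩
  rintro _ ⟨g, rfl⟩
  have h1 := abs_le.1 (abs_average_le hn (hG g g.2) z)
  have h2 := abs_le.1 (abs_integral_le_of_abs_le (ν := ν) (hG g g.2))
  simp only
  linarith [h1.1, h2.2]

/-- Symmetrization: the expected supremum of the deviation is at most twice the Rademacher
complexity. -/
theorem integral_supDeviation_le {G : Set (E → ℝ)} {C : ℝ} (hG : ∀ g ∈ G, ∀ z, |g z| ≤ C)
    (hne : G.Nonempty) (hn : 0 < n) (ν : Measure E) [IsProbabilityMeasure ν] :
    ∫ z, supDeviation G ν z ∂(Measure.pi fun _ : Fin n => ν) ≤ 2 * expRademacher n G ν := by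
  have : Nonempty G := hne.to_subtype
  set ρ : Measure (Fin n → E × E) := Measure.pi fun _ => ν.prod ν with hρ
  set D : (Fin n → Bool) → (Fin n → E × E) → ℝ := fun σ u =>
    ⨆ g : G, (n : ℝ)⁻¹ * ∑ i, (if σ i then (1 : ℝ) else -1)
      * ((g : E → ℝ) (u i).1 - (g : E → ℝ) (u i).2) with hD
  have hbdd : ∀ (σ : Fin n → Bool) (u : Fin n → E × E), BddAbove (Set.range fun g : G => (n : ℝ)⁻¹ * ∑ i,
      (if σ i then (1 : ℝ) else -1) * ((g : E → ℝ) (u i).1 - (g : E → ℝ) (u i).2)) := by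
    intro σ u
    have h1 := bddAbove_range_average hG (fun i => if σ i then (1 : ℝ) else -1) (fun i => (u i).1)
    have h2 := bddAbove_range_average hG (fun i => -(if σ i then (1 : ℝ) else -1))
      (fun i => (u i).2)
    obtain ⟨B1, h1⟩ := h1
    obtain ⟨B2, h2⟩ := h2
    refine ⟨B1 + B2, ?_⟩
    rintro _ ⟨g, rfl⟩
    refine le_trans (le_of_eq ?_) (add_le_add (h1 ⟨g, rfl⟩) (h2 ⟨g, rfl⟩))
    simp only [← mul_add, ← Finset.sum_add_distrib]
    congr 1
    exact Finset.sum_congr rfl fun i _ => by ring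
  -- Ghost sample: the mean of `g` is the expected average over an independent copy `z'`, and the
  -- supremum of an expectation is at most the expectation of the supremum.
  have hghost : ∫ z, supDeviation G ν z ∂(Measure.pi fun _ : Fin n => ν)
      ≤ ∫ u, D (fun _ => true) u ∂ρ := by
    have hpair : ∫ u, D (fun _ => true) u ∂ρ
        = ∫ z, ∫ z', D (fun _ => true) (fun i => (z' i, z i)) ∂(Measure.pi fun _ : Fin n => ν)
          ∂(Measure.pi fun _ : Fin n => ν) := by
      have hmp : MeasurePreserving
          (fun (p : (Fin n → E) × (Fin n → E)) i => (p.1 i, p.2 i))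
          ((Measure.pi fun _ => ν).prod (Measure.pi fun _ => ν)) ρ :=
        (measurePreserving_arrowProdEquivProdArrow E E (Fin n) (fun _ => ν) (fun _ => ν)).symm
      rw [← hmp.map_eq, integral_map hmp.measurable.aemeasurable
        (Measurable.of_discrete).aestronglyMeasurable, integral_prod_symm _ .of_finite]
    rw [hpair]
    refine integral_mono .of_finite .of_finite fun z => ciSup_le fun g => ?_
    rw [← integral_pi_average ν hn]
    have hsub : ∫ z', (n : ℝ)⁻¹ * ∑ i, (g : E → ℝ) (z' i) ∂(Measure.pi fun _ : Fin n => ν)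
        - (n : ℝ)⁻¹ * ∑ i, (g : E → ℝ) (z i)
        = ∫ z', ((n : ℝ)⁻¹ * ∑ i, (g : E → ℝ) (z' i) - (n : ℝ)⁻¹ * ∑ i, (g : E → ℝ) (z i))
          ∂(Measure.pi fun _ : Fin n => ν) := by
      rw [integral_sub .of_finite .of_finite]
      simp
    rw [hsub]
    refine integral_mono .of_finite .of_finite fun z' => ?_
    refine le_trans (le_of_eq ?_) (le_ciSup (hbdd (fun _ => true) fun i => (z' i, z i)) g)
    simp only [← mul_sub, ← Finset.sum_sub_distrib]
    simp
  -- Flipping the `i`-th sign amounts to exchanging the `i`-th point with its ghost, which leaves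
  -- the law unchanged. The expectation may therefore be averaged over all signs.
  have hswap : ∀ σ, ∫ u, D (fun _ => true) u ∂ρ = ∫ u, D σ u ∂ρ := by
    intro σ
    rw [hρ, integral_pi_prod_swap ν σ]
    congr 1
    ext u
    simp only [hD]
    congr 1
    ext g
    congr 1
    refine Finset.sum_congr rfl fun i _ => ?_
    cases h : σ i <;> simp
  have hsplit : ∀ σ u, D σ u
      ≤ (⨆ g : G, (n : ℝ)⁻¹ * ∑ i, (if σ i then (1 : ℝ) else -1) * (g : E → ℝ) (u i).1)
        + ⨆ g : G, (n : ℝ)⁻¹ * ∑ i, -(if σ i then (1 : ℝ) else -1) * (g : E → ℝ) (u i).2 := by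
    intro σ u
    refine ciSup_le fun g => ?_
    have h1 := le_ciSup (bddAbove_range_average hG (fun i => if σ i then (1 : ℝ) else -1)
      (fun i => (u i).1)) g
    have h2 := le_ciSup (bddAbove_range_average hG (fun i => -(if σ i then (1 : ℝ) else -1))
      (fun i => (u i).2)) g
    refine le_trans (le_of_eq ?_) (add_le_add h1 h2)
    simp only [← mul_add, ← Finset.sum_add_distrib]
    congr 1
    exact Finset.sum_congr rfl fun i _ => by ring
  refine hghost.trans ?_
  calc ∫ u, D (fun _ => true) u ∂ρ
      = ((2 : ℝ) ^ n)⁻¹ * ∑ σ : Fin n → Bool, ∫ u, D σ u ∂ρ := by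
        simp only [← hswap]
        simp
    _ = ∫ u, ((2 : ℝ) ^ n)⁻¹ * ∑ σ : Fin n → Bool, D σ u ∂ρ := by
        rw [integral_const_mul, integral_finsetSum _ fun _ _ => .of_finite]
    _ ≤ ∫ u, (empRademacher G (fun i => (u i).1) + empRademacher G (fun i => (u i).2)) ∂ρ := by
        refine integral_mono .of_finite .of_finite fun u => ?_
        simp only
        rw [empRademacher_eq_neg G fun i => (u i).2, empRademacher, ← mul_add,
          ← Finset.sum_add_distrib]
        exact mul_le_mul_of_nonneg_left (Finset.sum_le_sum fun σ _ => hsplit σ u) (by positivity)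
    _ = 2 * expRademacher n G ν := by
        rw [integral_add .of_finite .of_finite, integral_pi_prod_fst ν (empRademacher G),
          integral_pi_prod_snd ν (empRademacher G), expRademacher]
        ring

end Rademacher

/-! ### Tail bounds for independent samples -/

section Tail

variable {n : ℕ}

theorem abs_average_update_sub_le {Z : Type*} {g : Z → ℝ} {C : ℝ} (hg : ∀ z, |g z| ≤ C)
    (z : Fin n → Z) (i : Fin n) (e : Z) :
    |(n : ℝ)⁻¹ * ∑ j, g (Function.update z i e j) - (n : ℝ)⁻¹ * ∑ j, g (z j)| ≤ 2 * C / n := by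
  rw [← mul_sub, ← Finset.sum_sub_distrib, Finset.sum_eq_single i
    (fun j _ hj => by simp [Function.update_of_ne hj]) (by simp), abs_mul,
    abs_of_nonneg (by positivity : (0 : ℝ) ≤ (n : ℝ)⁻¹), div_eq_inv_mul]
  refine mul_le_mul_of_nonneg_left ?_ (by positivity)
  have h1 := abs_le.1 (hg (Function.update z i e i))
  have h2 := abs_le.1 (hg (z i))
  exact abs_le.2 ⟨by linarith [h1.1, h2.2], by linarith [h1.2, h2.1]⟩

theorem abs_supDeviation_update_sub_le {E : Type*} [MeasurableSpace E] {G : Set (E → ℝ)} {C : ℝ}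
    (hG : ∀ g ∈ G, ∀ z, |g z| ≤ C) (hne : G.Nonempty) (hn : 0 < n) (ν : Measure E)
    [IsProbabilityMeasure ν] (z : Fin n → E) (i : Fin n) (e : E) :
    |supDeviation G ν (Function.update z i e) - supDeviation G ν z| ≤ 2 * C / n := by
  have : Nonempty G := hne.to_subtype
  rw [abs_le]
  constructor
  · suffices supDeviation G ν z ≤ supDeviation G ν (Function.update z i e) + 2 * C / n by linarith
    refine ciSup_le fun g => ?_
    have h1 := le_ciSup (bddAbove_range_deviation hG hn ν (Function.update z i e)) g
    have h2 := abs_le.1 (abs_average_update_sub_le (hG g g.2) z i e)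
    unfold supDeviation
    linarith [h2.2]
  · suffices supDeviation G ν (Function.update z i e) ≤ supDeviation G ν z + 2 * C / n by linarith
    refine ciSup_le fun g => ?_
    have h1 := le_ciSup (bddAbove_range_deviation hG hn ν z) g
    have h2 := abs_le.1 (abs_average_update_sub_le (hG g g.2) z i e)
    unfold supDeviation
    linarith [h2.1]

variable {Ω : Type*} [MeasurableSpace Ω] {Pr : Measure Ω}

/-- The supremum of the deviation over a bounded class, plus the opposite deviation of a fixed
function, exceeds twice the Rademacher complexity by `t` with exponentially small probability. -/
theorem measure_supDeviation_add_gt_le {E : Type*} [Finite E] [MeasurableSpace E]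
    [MeasurableSingletonClass E] {G : Set (E → ℝ)} {C : ℝ} (hC : 0 < C)
    (hG : ∀ g ∈ G, ∀ z, |g z| ≤ C) {g₀ : E → ℝ} (hg₀ : g₀ ∈ G) (hn : 0 < n) (ν : Measure E)
    [IsProbabilityMeasure ν] {ξ : Fin n → Ω → E} (hindep : iIndepFun ξ Pr)
    (hlaw : ∀ i, HasLaw (ξ i) ν Pr) {t : ℝ} (ht : 0 ≤ t) :
    Pr {ω | 2 * expRademacher n G ν + t < supDeviation G ν (fun i => ξ i ω)
        + ((n : ℝ)⁻¹ * ∑ i, g₀ (ξ i ω) - ∫ e, g₀ e ∂ν)}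
      ≤ ENNReal.ofReal (Real.exp (-(n * t ^ 2) / (32 * C ^ 2))) := by
  have hne : G.Nonempty := ⟨g₀, hg₀⟩
  set ρ : Measure (Fin n → E) := Measure.pi fun _ => ν with hρ
  set Φ : (Fin n → E) → ℝ := fun z => supDeviation G ν z
    + ((n : ℝ)⁻¹ * ∑ i, g₀ (z i) - ∫ e, g₀ e ∂ν) with hΦ
  have hmean : ∫ z, Φ z ∂ρ ≤ 2 * expRademacher n G ν := by
    simp only [hΦ]
    rw [integral_add .of_finite .of_finite, integral_sub .of_finite .of_finite,
      integral_pi_average ν hn]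
    have := integral_supDeviation_le hG hne hn ν
    simpa [hρ] using this
  -- Changing one sample point moves the supremum and the average of `g₀` by at most `2C/n` each.
  -- The average of `g₀` is centred, so it adds nothing to the mean of `Φ`.
  obtain ⟨c, hc⟩ : ∃ c : ℝ≥0, (c : ℝ) = 4 * C / n := ⟨⟨4 * C / n, by positivity⟩, rfl⟩
  have hsub := hasSubgaussianMGF_of_bounded_differences ν c n Φ (by
    intro z i e
    have h1 := abs_le.1 (abs_supDeviation_update_sub_le hG hne hn ν z i e)
    have h2 := abs_le.1 (abs_average_update_sub_le (hG g₀ hg₀) z i e)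
    have h3 : 4 * C / n = 2 * C / n + 2 * C / n := by ring
    rw [hc, h3]
    simp only [hΦ]
    exact abs_le.2 ⟨by linarith [h1.1, h2.1], by linarith [h1.2, h2.2]⟩)
  have htail := hsub.measure_ge_le ht
  have hmap : Pr.map (fun ω i => ξ i ω) = ρ := by
    rw [hindep.map_fun_eq_pi_map fun i => (hlaw i).aemeasurable, hρ]
    congr 1
    ext1 i
    exact (hlaw i).map_eq
  have haem : AEMeasurable (fun ω i => ξ i ω) Pr := aemeasurable_pi_lambda _ fun i =>
    (hlaw i).aemeasurable
  calc Pr {ω | 2 * expRademacher n G ν + t < Φ fun i => ξ i ω}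
      ≤ Pr ((fun ω i => ξ i ω) ⁻¹' {z | t ≤ Φ z - ∫ y, Φ y ∂ρ}) := by
        refine measure_mono fun ω hω => ?_
        simp only [Set.mem_ofPred_eq, Set.mem_preimage] at hω ⊢
        linarith
    _ = ρ {z | t ≤ Φ z - ∫ y, Φ y ∂ρ} := by
        rw [← hmap, Measure.map_apply_of_aemeasurable haem (Set.toFinite _).measurableSet]
    _ = ENNReal.ofReal (ρ.real {z | t ≤ Φ z - ∫ y, Φ y ∂ρ}) := by simp
    _ ≤ _ := by
        refine ENNReal.ofReal_le_ofReal (htail.trans_eq ?_)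
        congr 1
        have hn' : (n : ℝ) ≠ 0 := by positivity
        simp only [NNReal.coe_mul, NNReal.coe_natCast, NNReal.coe_pow, hc]
        field_simp
        ring

/-- Hoeffding's inequality for the two-sided deviation of finitely many `[0,1]`-valued functions. -/
theorem measure_exists_abs_average_sub_gt_le {ι 𝓧 : Type*} [Fintype ι] [MeasurableSpace 𝓧]
    [IsProbabilityMeasure Pr] (ν : Measure 𝓧) {h : ι → 𝓧 → ℝ} (hmeas : ∀ j, Measurable (h j))
    (hmem : ∀ j, ∀ᵐ x ∂ν, h j x ∈ Set.Icc 0 1) (hn : 0 < n) {ξ : Fin n → Ω → 𝓧}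
    (hindep : iIndepFun ξ Pr) (hlaw : ∀ i, HasLaw (ξ i) ν Pr) {t : ℝ} (ht : 0 ≤ t) :
    Pr {ω | ∃ j, t < |(n : ℝ)⁻¹ * ∑ i, h j (ξ i ω) - ∫ x, h j x ∂ν|}
      ≤ ENNReal.ofReal (2 * Fintype.card ι * Real.exp (-(2 * n * t ^ 2))) := by
  have hn' : (0 : ℝ) < n := by exact_mod_cast hn
  set ε : ℝ := Real.exp (-(2 * n * t ^ 2)) with hε
  have hsub : ∀ j i, HasSubgaussianMGF (fun ω => h j (ξ i ω) - ∫ x, h j x ∂ν) (1 / 4) Pr := by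
    intro j i
    have hb : ∀ᵐ ω ∂Pr, h j (ξ i ω) ∈ Set.Icc 0 1 := by
      have := hmem j
      rw [← (hlaw i).map_eq] at this
      exact ae_of_ae_map (hlaw i).aemeasurable this
    have h1 := hasSubgaussianMGF_of_mem_Icc ((hmeas j).comp_aemeasurable (hlaw i).aemeasurable) hb
    have h2 : ∫ ω, h j (ξ i ω) ∂Pr = ∫ x, h j x ∂ν := by
      rw [← (hlaw i).map_eq,
        integral_map (hlaw i).aemeasurable (hmeas j).aestronglyMeasurable]
    have h3 : ((‖(1 : ℝ) - 0‖₊ / 2) ^ 2 : ℝ≥0) = 1 / 4 := by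
      ext
      norm_num
    rw [h3] at h1
    simp only [Function.comp_apply, h2] at h1
    exact h1
  have hexp : ∀ j, (fun i ω => h j (ξ i ω) - ∫ x, h j x ∂ν) =
      fun i => (fun x => h j x - ∫ x, h j x ∂ν) ∘ ξ i := fun j => rfl
  have hind : ∀ j, iIndepFun (fun i ω => h j (ξ i ω) - ∫ x, h j x ∂ν) Pr := fun j => by
    rw [hexp j]
    exact hindep.comp _ fun _ => (hmeas j).sub_const _
  -- Each summand has variance proxy `1/4`, so the sum has proxy `n/4`; the factor 2 in the exponent
  -- comes from this.
  have hnum : Real.exp (-(n * t) ^ 2 / (2 * ((∑ _i : Fin n, (1 / 4 : ℝ≥0) : ℝ≥0) : ℝ))) = ε := by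
    rw [hε]
    congr 1
    push_cast
    simp
    field_simp
    ring
  have hup : ∀ j, Pr {ω | n * t ≤ ∑ i, (h j (ξ i ω) - ∫ x, h j x ∂ν)} ≤ ENNReal.ofReal ε := by
    intro j
    rw [← ofReal_measureReal]
    refine ENNReal.ofReal_le_ofReal (le_of_le_of_eq ?_ hnum)
    exact HasSubgaussianMGF.measure_sum_ge_le_of_iIndepFun (hind j) (fun i _ => hsub j i)
      (by positivity)
  have hdown : ∀ j, Pr {ω | n * t ≤ ∑ i, -(h j (ξ i ω) - ∫ x, h j x ∂ν)} ≤ ENNReal.ofReal ε := by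
    intro j
    rw [← ofReal_measureReal]
    refine ENNReal.ofReal_le_ofReal (le_of_le_of_eq ?_ hnum)
    refine HasSubgaussianMGF.measure_sum_ge_le_of_iIndepFun
      (X := fun i ω => -(h j (ξ i ω) - ∫ x, h j x ∂ν)) ?_ (fun i _ => (hsub j i).neg)
      (by positivity)
    exact (hind j).comp (fun _ x => -x) fun _ => measurable_neg
  calc _ ≤ Pr (⋃ j, ({ω | n * t ≤ ∑ i, (h j (ξ i ω) - ∫ x, h j x ∂ν)}
            ∪ {ω | n * t ≤ ∑ i, -(h j (ξ i ω) - ∫ x, h j x ∂ν)})) := by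
        refine measure_mono ?_
        rintro ω ⟨j, hj⟩
        refine Set.mem_iUnion.2 ⟨j, ?_⟩
        have hav : (n : ℝ)⁻¹ * ∑ i, h j (ξ i ω) - ∫ x, h j x ∂ν
            = (n : ℝ)⁻¹ * ∑ i, (h j (ξ i ω) - ∫ x, h j x ∂ν) := by
          rw [Finset.sum_sub_distrib, mul_sub]
          simp [hn.ne']
        have hkey : ∀ s : ℝ, t < (n : ℝ)⁻¹ * s → n * t ≤ s := fun s hs => by
          have := mul_le_mul_of_nonneg_left hs.le hn'.le
          rwa [mul_inv_cancel_left₀ hn'.ne'] at this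
        rw [hav] at hj
        rcases lt_abs.1 hj with h1 | h1
        · exact Or.inl (hkey _ h1)
        · refine Or.inr (hkey _ ?_)
          rwa [Finset.sum_neg_distrib, mul_neg]
    _ ≤ ∑ j : ι, (ENNReal.ofReal ε + ENNReal.ofReal ε) :=
        (measure_iUnion_fintype_le _ _).trans (Finset.sum_le_sum fun j _ =>
          (measure_union_le _ _).trans (add_le_add (hup j) (hdown j)))
    _ = _ := by
        have hε0 : 0 ≤ ε := (Real.exp_pos _).le
        rw [← ENNReal.ofReal_add hε0 hε0, Finset.sum_const, nsmul_eq_mul, Finset.card_univ,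
          ← ENNReal.ofReal_natCast, ← ENNReal.ofReal_mul (by positivity)]
        congr 1
        ring

end Tail

/-! ### Linear and bilinear forms on boxes -/

section Box

variable {ι κ : Type*} [Fintype ι] [Fintype κ]

/-- The worst `w` in the box equals `C` where the coefficient is nonnegative and `0` elsewhere, so
testing the single subset of nonnegative coefficients is enough. -/
theorem sum_mul_le_of_forall_finset {a w : ι → ℝ} {C t : ℝ}
    (ha : ∀ U : Finset ι, ∑ x ∈ U, a x ≤ t) (hw : ∀ x, 0 ≤ w x ∧ w x ≤ C) (hC : 0 ≤ C) :
    ∑ x, w x * a x ≤ C * t := by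
  classical
  calc ∑ x, w x * a x ≤ ∑ x, if 0 ≤ a x then C * a x else 0 := by
        refine Finset.sum_le_sum fun x _ => ?_
        split_ifs with h
        · exact mul_le_mul_of_nonneg_right (hw x).2 h
        · exact mul_nonpos_of_nonneg_of_nonpos (hw x).1 (not_le.1 h).le
    _ = C * ∑ x ∈ Finset.univ.filter (fun x => 0 ≤ a x), a x := by
        rw [← Finset.sum_filter, Finset.mul_sum]
    _ ≤ C * t := mul_le_mul_of_nonneg_left (ha _) hC

/-- A linear form on the box `[0, C]^ι` is bounded by its values at the vertices. -/
theorem abs_sum_mul_le_of_forall_finset {a w : ι → ℝ} {C t : ℝ}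
    (ha : ∀ U : Finset ι, |∑ x ∈ U, a x| ≤ t) (hw : ∀ x, 0 ≤ w x ∧ w x ≤ C) (hC : 0 ≤ C) :
    |∑ x, w x * a x| ≤ C * t := by
  refine abs_le.2 ⟨?_, sum_mul_le_of_forall_finset (fun U => (abs_le.1 (ha U)).2) hw hC⟩
  have h := sum_mul_le_of_forall_finset (a := fun x => -a x) (t := t)
    (fun U => by rw [Finset.sum_neg_distrib]; linarith [(abs_le.1 (ha U)).1]) hw hC
  simp only [mul_neg, Finset.sum_neg_distrib] at h
  linarith

/-- A bilinear form on a product of boxes is bounded by its values at the vertices. -/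
theorem abs_sum_sum_mul_le_of_forall_finset {a : ι → κ → ℝ} {w : ι → ℝ} {v : κ → ℝ} {C C' t : ℝ}
    (ha : ∀ (U : Finset ι) (U' : Finset κ), |∑ x ∈ U, ∑ y ∈ U', a x y| ≤ t)
    (hw : ∀ x, 0 ≤ w x ∧ w x ≤ C) (hv : ∀ y, 0 ≤ v y ∧ v y ≤ C') (hC : 0 ≤ C) (hC' : 0 ≤ C') :
    |∑ x, ∑ y, w x * v y * a x y| ≤ C * C' * t := by
  have h : ∀ U : Finset ι, |∑ x ∈ U, ∑ y, v y * a x y| ≤ C' * t := fun U => by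
    rw [Finset.sum_comm]
    simp only [← Finset.mul_sum]
    refine abs_sum_mul_le_of_forall_finset (fun U' => ?_) hv hC'
    rw [Finset.sum_comm]
    exact ha U U'
  have h2 := abs_sum_mul_le_of_forall_finset h hw hC
  simpa only [Finset.mul_sum, mul_assoc] using h2

end Box

/-! ### Expectations under finite distributions -/

section FinitePMF

variable {α β : Type*} [Fintype α] [Fintype β]

theorem sum_pmf_toReal (p : PMF α) : ∑ a, (p a).toReal = 1 := by
  have h : ∑ a, p a = 1 := by rw [← p.tsum_coe, tsum_fintype]
  rw [← ENNReal.toReal_sum fun a _ => p.apply_ne_top a, h, ENNReal.toReal_one]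

theorem sum_pmf_bind_mul (p : PMF α) (k : α → PMF β) (f : β → ℝ) :
    ∑ b, ((p.bind k) b).toReal * f b = ∑ a, (p a).toReal * ∑ b, (k a b).toReal * f b := by
  simp only [PMF.bind_apply, tsum_fintype, Finset.mul_sum]
  rw [Finset.sum_comm]
  refine Finset.sum_congr rfl fun b _ => ?_
  rw [ENNReal.toReal_sum fun a _ => ENNReal.mul_ne_top (p.apply_ne_top a) ((k a).apply_ne_top b),
    Finset.sum_mul]
  exact Finset.sum_congr rfl fun a _ => by rw [ENNReal.toReal_mul, mul_assoc]

theorem sum_pmf_pure_mul (a : α) (f : α → ℝ) : ∑ b, ((PMF.pure a) b).toReal * f b = f a := by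
  classical
  rw [Finset.sum_eq_single a (fun b _ hb => by simp [PMF.pure_apply, hb]) (by simp)]
  simp [PMF.pure_apply]

theorem sum_pmf_map_mul (p : PMF α) (g : α → β) (f : β → ℝ) :
    ∑ b, ((p.map g) b).toReal * f b = ∑ a, (p a).toReal * f (g a) := by
  rw [← PMF.bind_pure_comp, sum_pmf_bind_mul]
  simp only [Function.comp_apply, sum_pmf_pure_mul]

theorem sum_pmf_mul_mem_Icc (p : PMF α) {f : α → ℝ} {C : ℝ} (hf : ∀ a, 0 ≤ f a ∧ f a ≤ C) :
    0 ≤ ∑ a, (p a).toReal * f a ∧ ∑ a, (p a).toReal * f a ≤ C := by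
  refine ⟨Finset.sum_nonneg fun a _ => mul_nonneg ENNReal.toReal_nonneg (hf a).1, ?_⟩
  calc ∑ a, (p a).toReal * f a ≤ ∑ a, (p a).toReal * C :=
        Finset.sum_le_sum fun a _ => mul_le_mul_of_nonneg_left (hf a).2 ENNReal.toReal_nonneg
    _ = C := by rw [← Finset.sum_mul, sum_pmf_toReal, one_mul]

end FinitePMF

/-! ### Occupancies -/

section Occupancy

variable {S A : Type*} (M : Env S A) (P : S → A → PMF S) (π : S → PMF A)

theorem summable_discounted_stateActionLaw (x : S × A) :
    Summable fun t : ℕ => M.γ ^ t * (stateActionLaw M P π t x).toReal := by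
  refine Summable.of_nonneg_of_le
    (fun t => mul_nonneg (pow_nonneg M.γ_nonneg t) ENNReal.toReal_nonneg) (fun t => ?_)
    (summable_geometric_of_lt_one M.γ_nonneg M.γ_lt_one)
  refine mul_le_of_le_one_right (pow_nonneg M.γ_nonneg t) ?_
  exact ENNReal.toReal_le_of_le_ofReal zero_le_one (by simpa using PMF.coe_le_one _ _)

theorem occ_nonneg (x : S × A) : 0 ≤ occ M P π x :=
  mul_nonneg (sub_nonneg.2 M.γ_lt_one.le)
    (tsum_nonneg fun t => mul_nonneg (pow_nonneg M.γ_nonneg t) ENNReal.toReal_nonneg)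

theorem integrable_reward (x : S × A) : Integrable (fun r : ℝ => r) (M.R x) := by
  have := M.R_prob x
  exact Integrable.of_mem_Icc 0 M.Rmax measurable_id.aemeasurable (M.R_mem x)

theorem integral_reward_mem_Icc (x : S × A) :
    0 ≤ ∫ r, r ∂(M.R x) ∧ ∫ r, r ∂(M.R x) ≤ M.Rmax := by
  have := M.R_prob x
  refine ⟨integral_nonneg_of_ae ((M.R_mem x).mono fun r hr => hr.1), ?_⟩
  calc ∫ r, r ∂(M.R x) ≤ ∫ _, M.Rmax ∂(M.R x) :=
        integral_mono_ae (integrable_reward M x) (integrable_const _)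
          ((M.R_mem x).mono fun r hr => hr.2)
    _ = M.Rmax := by simp

theorem Env.Rmax_nonneg [Nonempty (S × A)] : 0 ≤ M.Rmax := by
  obtain ⟨x⟩ : Nonempty (S × A) := inferInstance
  exact (integral_reward_mem_Icc M x).1.trans (integral_reward_mem_Icc M x).2

variable [Fintype A]

theorem underPolicy_mem_Icc {f : S × A → ℝ} {C : ℝ} (hf : ∀ x, 0 ≤ f x ∧ f x ≤ C) (s : S) :
    0 ≤ underPolicy π f s ∧ underPolicy π f s ≤ C :=
  sum_pmf_mul_mem_Icc _ fun _ => hf _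

variable [Fintype S]

theorem initialValue_mem_Icc {f : S × A → ℝ} {C : ℝ} (hf : ∀ x, 0 ≤ f x ∧ f x ≤ C) :
    0 ≤ initialValue M π f ∧ initialValue M π f ≤ C :=
  sum_pmf_mul_mem_Icc _ fun s => underPolicy_mem_Icc π hf s

theorem sum_stateActionLaw_mul (t : ℕ) (f : S × A → ℝ) :
    ∑ x, (stateActionLaw M P π t x).toReal * f x
      = ∑ s, (stateLaw M P π t s).toReal * underPolicy π f s := by
  unfold stateActionLaw underPolicy
  rw [sum_pmf_bind_mul]
  simp only [sum_pmf_map_mul]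

theorem sum_stateLaw_succ_mul (t : ℕ) (v : S → ℝ) :
    ∑ s, (stateLaw M P π (t + 1) s).toReal * v s
      = ∑ x, (stateActionLaw M P π t x).toReal * ∑ s', (P x.1 x.2 s').toReal * v s' := by
  rw [sum_stateActionLaw_mul]
  simp only [stateLaw, sum_pmf_bind_mul]
  rfl

theorem hasSum_occ_mul (f : S × A → ℝ) :
    HasSum (fun t : ℕ => (1 - M.γ) * (M.γ ^ t * ∑ x, (stateActionLaw M P π t x).toReal * f x))
      (∑ x, occ M P π x * f x) := by
  have h := hasSum_sum (s := (Finset.univ : Finset (S × A))) fun x _ =>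
    (((summable_discounted_stateActionLaw M P π x).hasSum.mul_left (1 - M.γ)).mul_right (f x))
  refine h.congr_fun fun t => ?_
  simp only [Finset.mul_sum]
  exact Finset.sum_congr rfl fun x _ => by ring

theorem sum_occ : ∑ x, occ M P π x = 1 := by
  have h := hasSum_occ_mul M P π fun _ => 1
  simp only [mul_one, sum_pmf_toReal] at h
  have h2 := (hasSum_geometric_of_lt_one M.γ_nonneg M.γ_lt_one).mul_left (1 - M.γ)
  rw [mul_inv_cancel₀ (sub_ne_zero.2 M.γ_lt_one.ne')] at h2
  exact h.unique h2

/-- The Bellman flow equation of the occupancy, tested against `q`. -/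
theorem sum_occ_mul_td (q : S × A → ℝ) :
    ∑ x, occ M P π x * (q x - M.γ * ∑ s', (P x.1 x.2 s').toReal * underPolicy π q s')
      = (1 - M.γ) * initialValue M π q := by
  set e : ℕ → ℝ := fun t => ∑ s, (stateLaw M P π t s).toReal * underPolicy π q s with he
  have hq := hasSum_occ_mul M P π q
  have hv := hasSum_occ_mul M P π fun x => ∑ s', (P x.1 x.2 s').toReal * underPolicy π q s'
  simp only [← sum_stateLaw_succ_mul] at hv
  simp only [sum_stateActionLaw_mul] at hq
  -- The successor state at time `t` has the law of the state at time `t + 1`, so the `γ`-discounted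
  -- successor series is the `q` series without its term `t = 0`. Only the initial value survives
  -- the subtraction.
  have hq' := (hasSum_nat_add_iff' 1).2 hq
  have hv' := hv.mul_left M.γ
  have hfun : (fun t => M.γ * ((1 - M.γ) * (M.γ ^ t * e (t + 1))))
      = fun t => (1 - M.γ) * (M.γ ^ (t + 1) * e (t + 1)) := by
    funext t
    ring
  have h := hq'.unique (hfun ▸ hv')
  simp only [Finset.range_one, Finset.sum_singleton, pow_zero, one_mul] at h
  simp only [mul_sub, Finset.sum_sub_distrib]
  have h3 : ∑ x, occ M P π x * (M.γ * ∑ s', (P x.1 x.2 s').toReal * underPolicy π q s')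
      = M.γ * ∑ x, occ M P π x * ∑ s', (P x.1 x.2 s').toReal * underPolicy π q s' := by
    rw [Finset.mul_sum]
    exact Finset.sum_congr rfl fun x _ => by ring
  have h4 : initialValue M π q = ∑ s, (stateLaw M P π 0 s).toReal * underPolicy π q s := rfl
  rw [h3, h4]
  linarith

theorem sum_occ_mul_mem_Icc {f : S × A → ℝ} {C : ℝ} (hf : ∀ x, 0 ≤ f x ∧ f x ≤ C) :
    0 ≤ ∑ x, occ M P π x * f x ∧ ∑ x, occ M P π x * f x ≤ C := by
  refine ⟨Finset.sum_nonneg fun x _ => mul_nonneg (occ_nonneg M P π x) (hf x).1, ?_⟩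
  calc ∑ x, occ M P π x * f x ≤ ∑ x, occ M P π x * C :=
        Finset.sum_le_sum fun x _ => mul_le_mul_of_nonneg_left (hf x).2 (occ_nonneg M P π x)
    _ = C := by rw [← Finset.sum_mul, sum_occ, one_mul]

theorem J_mem_Icc : 0 ≤ J M P π ∧ J M P π ≤ M.Rmax :=
  sum_occ_mul_mem_Icc M P π fun x => integral_reward_mem_Icc M x

/-! ### Integrals against the sampling laws -/

variable [MeasurableSpace S] [MeasurableSpace A]

instance isProbabilityMeasure_transitionLaw (μ : PMF (S × A)) :
    IsProbabilityMeasure (transitionLaw P μ) := by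
  unfold transitionLaw
  infer_instance

instance isProbabilityMeasure_occLaw : IsProbabilityMeasure (occLaw M P π) := by
  constructor
  simp only [occLaw, Measure.coe_finsetSum, Finset.sum_apply, Measure.smul_apply, measure_univ,
    smul_eq_mul, mul_one]
  rw [← ENNReal.ofReal_sum_of_nonneg fun x _ => occ_nonneg M P π x, sum_occ, ENNReal.ofReal_one]

instance isProbabilityMeasure_occRewardLaw : IsProbabilityMeasure (occRewardLaw M P π) := by
  have := M.R_prob
  constructor
  simp only [occRewardLaw, Measure.coe_finsetSum, Finset.sum_apply, Measure.smul_apply,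
    measure_univ, smul_eq_mul, mul_one]
  rw [← ENNReal.ofReal_sum_of_nonneg fun x _ => occ_nonneg M P π x, sum_occ, ENNReal.ofReal_one]

theorem occRewardLaw_reward_mem_Icc :
    ∀ᵐ y ∂(occRewardLaw M P π), y.2 ∈ Set.Icc 0 M.Rmax := by
  have := M.R_prob
  have hs : MeasurableSet {y : (S × A) × ℝ | y.2 ∈ Set.Icc 0 M.Rmax} :=
    measurable_snd measurableSet_Icc
  unfold occRewardLaw
  rw [ae_iff]
  simp only [Measure.coe_finsetSum, Finset.sum_apply, Measure.smul_apply, smul_eq_mul]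
  refine Finset.sum_eq_zero fun x _ => ?_
  refine mul_eq_zero_of_right _ ?_
  rw [← ae_iff, Measure.dirac_prod, ae_map_iff (by fun_prop) hs]
  exact M.R_mem x

variable [MeasurableSingletonClass S] [MeasurableSingletonClass A]

theorem integral_transitionLaw (μ : PMF (S × A)) (h : (S × A) × S → ℝ) :
    ∫ z, h z ∂(transitionLaw P μ)
      = ∑ x, (μ x).toReal * ∑ s', (P x.1 x.2 s').toReal * h (x, s') := by
  unfold transitionLaw
  rw [PMF.integral_eq_sum]
  simp only [smul_eq_mul, sum_pmf_bind_mul, sum_pmf_map_mul]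

theorem integral_occLaw (f : S × A → ℝ) :
    ∫ x, f x ∂(occLaw M P π) = ∑ x, occ M P π x * f x := by
  unfold occLaw
  rw [integral_finsetSum_measure fun x _ =>
    (Integrable.of_finite (μ := Measure.dirac x)).smul_measure ENNReal.ofReal_ne_top]
  refine Finset.sum_congr rfl fun x _ => ?_
  rw [integral_smul_measure, integral_dirac, ENNReal.toReal_ofReal (occ_nonneg M P π x),
    smul_eq_mul]

theorem integral_occRewardLaw (f : S × A → ℝ) :
    ∫ y, f y.1 * y.2 ∂(occRewardLaw M P π)
      = ∑ x, occ M P π x * (f x * ∫ r, r ∂(M.R x)) := by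
  have := M.R_prob
  have hmeas : Measurable fun y : (S × A) × ℝ => f y.1 * y.2 :=
    ((Measurable.of_discrete (f := f)).comp measurable_fst).mul measurable_snd
  have hint : ∀ x, Integrable (fun y : (S × A) × ℝ => f y.1 * y.2)
      ((Measure.dirac x).prod (M.R x)) := by
    intro x
    rw [Measure.dirac_prod, integrable_map_measure hmeas.aestronglyMeasurable
      (by fun_prop)]
    exact (integrable_reward M x).const_mul (f x)
  unfold occRewardLaw
  rw [integral_finsetSum_measure fun x _ => (hint x).smul_measure ENNReal.ofReal_ne_top]
  refine Finset.sum_congr rfl fun x _ => ?_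
  rw [integral_smul_measure, ENNReal.toReal_ofReal (occ_nonneg M P π x), smul_eq_mul,
    Measure.dirac_prod, integral_map (by fun_prop) hmeas.aestronglyMeasurable]
  have h : ∫ r, f x * r ∂(M.R x) = f x * ∫ r, r ∂(M.R x) := integral_const_mul _ _
  exact congrArg (occ M P π x * ·) h

end Occupancy

/-! ### The density ratio estimator -/

section Ratio

/-- The generalized Kullback-Leibler integrand dominates the Hellinger integrand. -/
theorem sq_sqrt_sub_sqrt_le {b f : ℝ} (hb : 0 < b) (hf : 0 < f) :
    (√b - √f) ^ 2 ≤ b * (Real.log b - Real.log f) - b + f := by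
  have hsb := Real.sqrt_pos.2 hb
  have hsf := Real.sqrt_pos.2 hf
  -- Applying `log x ≤ x - 1` to the ratio of square roots, and multiplying by `b`, produces the
  -- cross term `√b √f` of the Hellinger integrand.
  have hlog := Real.log_le_sub_one_of_pos (div_pos hsf hsb)
  rw [Real.log_div hsf.ne' hsb.ne', Real.log_sqrt hf.le, Real.log_sqrt hb.le] at hlog
  have h := mul_le_mul_of_nonneg_left hlog (mul_nonneg hsb.le hsb.le)
  have h2 : √b * √b * (√f / √b - 1) = √b * √f - √b * √b := by
    field_simp
  rw [h2, Real.mul_self_sqrt hb.le] at h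
  have h3 : (√b - √f) ^ 2 = b - 2 * (√b * √f) + f := by
    rw [sub_sq, Real.sq_sqrt hb.le, Real.sq_sqrt hf.le]
    ring
  linarith

/-- Factor `f - b = (√f - √b)(√f + √b)` and put `d = |√f - √b|`; then `|f - b| ≤ 2 d √b + d²`. The
weight `B ≥ b` gives `d √b ≤ 2√θ`, while `B ≥ 1` gives `d² ≤ 4θ ≤ 4√θ`. Keeping the factor `√b` is
what yields linear dependence on `B` under the root. -/
theorem abs_sub_le_of_mul_sq_sqrt_sub_le {b f B θ : ℝ} (hb : 0 ≤ b) (hf : 0 ≤ f) (hbB : b ≤ B)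
    (hB : 1 ≤ B) (hθ : θ ≤ 1) (h : B * (√b - √f) ^ 2 ≤ 4 * θ) : |f - b| ≤ 8 * √θ := by
  have hθ0 : 0 ≤ θ := by nlinarith [sq_nonneg (√b - √f)]
  set d := |√f - √b| with hd
  have hd0 : 0 ≤ d := abs_nonneg _
  have hd2 : d ^ 2 = (√b - √f) ^ 2 := by rw [hd, sq_abs]; ring
  have hθs : θ ≤ √θ := Real.le_sqrt_of_sq_le (by nlinarith)
  have h1 : d ^ 2 ≤ 4 * θ := by nlinarith [sq_nonneg d]
  have h2 : d * √b ≤ 2 * √θ := by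
    have h4 : 2 * √θ = √(4 * θ) := by
      rw [Real.sqrt_mul (by norm_num), show (4 : ℝ) = 2 ^ 2 by norm_num,
        Real.sqrt_sq (by norm_num)]
    rw [h4]
    refine Real.le_sqrt_of_sq_le ?_
    rw [mul_pow, Real.sq_sqrt hb]
    nlinarith [sq_nonneg d]
  have h3 : √f ≤ √b + d := by
    have := le_abs_self (√f - √b)
    linarith
  have h5 : f - b = (√f - √b) * (√f + √b) := by
    linarith [Real.mul_self_sqrt hf, Real.mul_self_sqrt hb,
      show (√f - √b) * (√f + √b) = √f * √f - √b * √b by ring]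
  rw [h5, abs_mul, abs_of_nonneg (add_nonneg (Real.sqrt_nonneg f) (Real.sqrt_nonneg b))]
  calc d * (√f + √b) ≤ d * ((√b + d) + √b) := by gcongr
    _ = 2 * (d * √b) + d ^ 2 := by ring
    _ ≤ 8 * √θ := by linarith

variable {S A : Type*} {n : ℕ}

theorem mass_mul_betaRatio (M : Env S A) (P : S → A → PMF S) (π : S → PMF A) {μ : PMF (S × A)}
    (hμ : ∀ x, μ x ≠ 0) (x : S × A) :
    (μ x).toReal * betaRatio M P π μ x = occ M P π x :=
  mul_div_cancel₀ _ (ENNReal.toReal_ne_zero.2 ⟨hμ x, μ.apply_ne_top x⟩)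

theorem ratioObjective_eq (X Y : Fin n → S × A) (f : S × A → ℝ) :
    ratioObjective X Y f = -((n : ℝ)⁻¹ * ∑ i, (f (X i) - Real.log (f (Y i)))) := by
  rw [ratioObjective, Finset.sum_sub_distrib]
  ring

theorem abs_ratioClass_le {F : Set (S × A → ℝ)} {Cmin Cmax : ℝ} (hCmin : 0 < Cmin)
    (hF : ∀ f ∈ F, ∀ x, Cmin ≤ f x ∧ f x ≤ Cmax) :
    ∀ g ∈ ratioClass F, ∀ p, |g p| ≤ classConst Cmin Cmax := by
  rintro _ ⟨f, hf, rfl⟩ p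
  have h1 := hF f hf p.1
  have h2 := hF f hf p.2
  have hpos : 0 < f p.2 := hCmin.trans_le h2.1
  have h3 : Real.log (f p.2) ≤ Real.log Cmax := Real.log_le_log hpos h2.2
  have h4 : Real.log Cmin ≤ Real.log (f p.2) := Real.log_le_log hCmin h2.1
  have h5 := le_max_left (Real.log Cmax) (-Real.log Cmin)
  have h6 := le_max_right (Real.log Cmax) (-Real.log Cmin)
  have h7 : 0 < f p.1 := hCmin.trans_le h1.1
  unfold classConst
  exact abs_le.2 ⟨by linarith [h1.2], by linarith [h1.2]⟩

/-- The excess risk of an empirical maximizer is at most the supremum of the deviation. -/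
theorem excess_risk_le_supDeviation [MeasurableSpace S] [MeasurableSpace A]
    {ν : Measure ((S × A) × (S × A))} [IsProbabilityMeasure ν]
    {F : Set (S × A → ℝ)} {Cmin Cmax : ℝ} (hCmin : 0 < Cmin)
    (hF : ∀ f ∈ F, ∀ x, Cmin ≤ f x ∧ f x ≤ Cmax) (hn : 0 < n) {X Y : Fin n → S × A}
    {b f : S × A → ℝ} (hf : f ∈ F) (hopt : ratioObjective X Y b ≤ ratioObjective X Y f) :
    ∫ p, (f p.1 - Real.log (f p.2)) ∂ν - ∫ p, (b p.1 - Real.log (b p.2)) ∂ν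
      ≤ supDeviation (ratioClass F) ν (fun i => (X i, Y i))
        + ((n : ℝ)⁻¹ * ∑ i, (b (X i) - Real.log (b (Y i)))
          - ∫ p, (b p.1 - Real.log (b p.2)) ∂ν) := by
  rw [ratioObjective_eq, ratioObjective_eq] at hopt
  have h := le_ciSup (bddAbove_range_deviation (abs_ratioClass_le hCmin hF) hn ν
    (fun i => (X i, Y i))) ⟨fun p => f p.1 - Real.log (f p.2), f, hf, rfl⟩
  unfold supDeviation
  simp only at h
  linarith

variable [Fintype S] [Fintype A] [MeasurableSpace S] [MeasurableSpace A]
  [MeasurableSingletonClass S] [MeasurableSingletonClass A]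
  (M : Env S A) (P : S → A → PMF S) (π : S → PMF A)

theorem integral_ratio (μ : PMF (S × A)) (f : S × A → ℝ) :
    ∫ p, (f p.1 - Real.log (f p.2)) ∂(μ.toMeasure.prod (occLaw M P π))
      = ∑ x, (μ x).toReal * f x - ∑ x, occ M P π x * Real.log (f x) := by
  rw [integral_sub .of_finite .of_finite, integral_fun_fst,
    integral_fun_snd fun y => Real.log (f y), integral_occLaw, PMF.integral_eq_sum]
  simp

/-- The excess risk of the density ratio estimator controls the pointwise Hellinger distance to
the true ratio. -/
theorem mass_mul_sq_sqrt_betaRatio_sub_le {μ : PMF (S × A)} (hμ : ∀ x, μ x ≠ 0)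
    (hβ : ∀ x, 0 < betaRatio M P π μ x) {f : S × A → ℝ} (hf : ∀ x, 0 < f x) (x : S × A) :
    (μ x).toReal * (√(betaRatio M P π μ x) - √(f x)) ^ 2
      ≤ ∫ p, (f p.1 - Real.log (f p.2)) ∂(μ.toMeasure.prod (occLaw M P π))
        - ∫ p, (betaRatio M P π μ p.1 - Real.log (betaRatio M P π μ p.2))
            ∂(μ.toMeasure.prod (occLaw M P π)) := by
  rw [integral_ratio, integral_ratio]
  calc (μ x).toReal * (√(betaRatio M P π μ x) - √(f x)) ^ 2
      ≤ ∑ x, (μ x).toReal * (√(betaRatio M P π μ x) - √(f x)) ^ 2 :=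
        Finset.single_le_sum (f := fun x => (μ x).toReal * (√(betaRatio M P π μ x) - √(f x)) ^ 2)
          (fun x _ => mul_nonneg ENNReal.toReal_nonneg (sq_nonneg _)) (Finset.mem_univ x)
    _ ≤ ∑ x, (μ x).toReal * (betaRatio M P π μ x *
          (Real.log (betaRatio M P π μ x) - Real.log (f x)) - betaRatio M P π μ x + f x) :=
        Finset.sum_le_sum fun x _ => mul_le_mul_of_nonneg_left
          (sq_sqrt_sub_sqrt_le (hβ x) (hf x)) ENNReal.toReal_nonneg
    -- Since `μ β` is the occupancy, the divergence is the difference of the two risks, term by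
    -- term.
    _ = _ := by
        simp only [← Finset.sum_sub_distrib]
        refine Finset.sum_congr rfl fun x _ => ?_
        rw [← mass_mul_betaRatio M P π hμ x]
        ring

end Ratio

/-! ### The loss of the Q-function estimator -/

section Loss

variable {S A : Type*} [Fintype A] (M : Env S A) (Pte Ptr : S → A → PMF S) (π : S → PMF A)
  {n : ℕ}

theorem abs_td_le {C : ℝ} {q : S × A → ℝ} (hq : ∀ x, 0 ≤ q x ∧ q x ≤ C) (x : S × A) (s : S) :
    |q x - M.γ * underPolicy π q s| ≤ C := by
  have h1 := hq x
  have h2 := underPolicy_mem_Icc π hq s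
  have h3 : M.γ * underPolicy π q s ≤ C :=
    (mul_le_of_le_one_left h2.1 M.γ_lt_one.le).trans h2.2
  have h4 : 0 ≤ M.γ * underPolicy π q s := mul_nonneg M.γ_nonneg h2.1
  exact abs_le.2 ⟨by linarith, by linarith⟩

theorem abs_tdClass_le {W Q : Set (S × A → ℝ)} {CW CQ B : ℝ}
    (hW : ∀ w ∈ W, ∀ x, 0 ≤ w x ∧ w x ≤ CW) (hQ : ∀ q ∈ Q, ∀ x, 0 ≤ q x ∧ q x ≤ CQ)
    {b : S × A → ℝ} (hb : ∀ x, |b x| ≤ B) (hCW : 0 ≤ CW) :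
    ∀ g ∈ tdClass M π b W Q, ∀ z, |g z| ≤ CW * B * CQ := by
  rintro _ ⟨w, hw, q, hq, rfl⟩ z
  have hB : 0 ≤ B := (abs_nonneg _).trans (hb z.1)
  rw [tdTerm, abs_mul, abs_mul]
  refine mul_le_mul (mul_le_mul ?_ (hb _) (abs_nonneg _) hCW) (abs_td_le M π (hQ q hq) _ _)
    (abs_nonneg _) (mul_nonneg hCW hB)
  rw [abs_of_nonneg (hW w hw _).1]
  exact (hW w hw _).2

/-- The empirical loss depends on the density ratio in a Lipschitz way. -/
theorem abs_average_tdTerm_sub_le {w b b' q : S × A → ℝ} {CW CQ ε : ℝ} (hn : 0 < n)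
    (hw : ∀ x, 0 ≤ w x ∧ w x ≤ CW) (hq : ∀ x, 0 ≤ q x ∧ q x ≤ CQ) (hb : ∀ x, |b x - b' x| ≤ ε)
    (hCW : 0 ≤ CW) (T : Fin n → (S × A) × S) :
    |(n : ℝ)⁻¹ * ∑ i, tdTerm M π w b q (T i) - (n : ℝ)⁻¹ * ∑ i, tdTerm M π w b' q (T i)|
      ≤ CW * ε * CQ := by
  have h : (n : ℝ)⁻¹ * ∑ i, tdTerm M π w b q (T i) - (n : ℝ)⁻¹ * ∑ i, tdTerm M π w b' q (T i)
      = (n : ℝ)⁻¹ * ∑ i, tdTerm M π w (fun x => b x - b' x) q (T i) := by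
    rw [← mul_sub, ← Finset.sum_sub_distrib]
    congr 1
    refine Finset.sum_congr rfl fun i _ => ?_
    unfold tdTerm
    ring
  rw [h]
  refine abs_average_le hn (fun z => ?_) T
  exact abs_tdClass_le M π (W := {w}) (Q := {q}) (by simpa using hw) (by simpa using hq) hb hCW _
    ⟨w, rfl, q, rfl, rfl⟩ z

variable [Fintype S]

/-- The true weight has mean one under the simulator occupancy and inherits the upper bound of `W`
through the convex hull. This lets `CW` be dropped when the error is bounded trivially. -/
theorem one_le_of_weightRatio_mem_convexHull {W : Set (S × A → ℝ)} {CW : ℝ}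
    (hocc : ∀ x, occ M Ptr π x ≠ 0) (hW : ∀ w ∈ W, ∀ x, 0 ≤ w x ∧ w x ≤ CW)
    (hw : weightRatio M Pte Ptr π ∈ convexHull ℝ W) : 1 ≤ CW := by
  have hle : ∀ x, weightRatio M Pte Ptr π x ≤ CW := by
    have hsub : convexHull ℝ W ⊆ {w | ∀ x, w x ≤ CW} := by
      refine convexHull_min (fun w hw x => (hW w hw x).2) ?_
      intro w₁ h₁ w₂ h₂ a₁ a₂ ha₁ ha₂ ha x
      simp only [Pi.add_apply, Pi.smul_apply, smul_eq_mul]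
      calc a₁ * w₁ x + a₂ * w₂ x ≤ a₁ * CW + a₂ * CW :=
            add_le_add (mul_le_mul_of_nonneg_left (h₁ x) ha₁)
              (mul_le_mul_of_nonneg_left (h₂ x) ha₂)
        _ = CW := by rw [← add_mul, ha, one_mul]
    exact hsub hw
  calc (1 : ℝ) = ∑ x, occ M Pte π x := (sum_occ M Pte π).symm
    _ = ∑ x, weightRatio M Pte Ptr π x * occ M Ptr π x :=
        Finset.sum_congr rfl fun x _ => (div_mul_cancel₀ _ (hocc x)).symm
    _ ≤ ∑ x, CW * occ M Ptr π x := Finset.sum_le_sum fun x _ =>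
        mul_le_mul_of_nonneg_right (hle x) (occ_nonneg M Ptr π x)
    _ = CW := by rw [← Finset.mul_sum, sum_occ, mul_one]

variable [MeasurableSpace S] [MeasurableSpace A]
  [MeasurableSingletonClass S] [MeasurableSingletonClass A] (μ : PMF (S × A))

/-- The coefficient of `w(s,a)` in the signed population loss. -/
noncomputable def lossCoeff (b q : S × A → ℝ) (x : S × A) : ℝ :=
  (μ x).toReal * (b x * (q x - M.γ * ∑ s', (Pte x.1 x.2 s').toReal * underPolicy π q s'))
    - occ M Ptr π x * ∫ r, r ∂(M.R x)

/-- Integrating out the next state and the reward exposes the loss as the absolute value of a linear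
form in `w`; boundedness over `W` and convexity in `w` both follow from this. -/
theorem lossQ_eq (w b q : S × A → ℝ) :
    lossQ M Pte Ptr π μ w b q = |∑ x, w x * lossCoeff M Pte Ptr π μ b q x| := by
  unfold lossQ lossCoeff
  rw [integral_transitionLaw, integral_occRewardLaw, ← Finset.sum_sub_distrib]
  congr 1
  refine Finset.sum_congr rfl fun x _ => ?_
  have h : ∑ s', (Pte x.1 x.2 s').toReal * tdTerm M π w b q (x, s')
      = w x * b x * (q x - M.γ * ∑ s', (Pte x.1 x.2 s').toReal * underPolicy π q s') := by
    calc _ = (∑ s', (Pte x.1 x.2 s').toReal) * (w x * b x * q x)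
          - w x * b x * (M.γ * ∑ s', (Pte x.1 x.2 s').toReal * underPolicy π q s') := by
          rw [Finset.sum_mul, Finset.mul_sum, Finset.mul_sum, ← Finset.sum_sub_distrib]
          refine Finset.sum_congr rfl fun s' _ => ?_
          unfold tdTerm
          ring
      _ = _ := by rw [sum_pmf_toReal]; ring
  rw [h]
  ring

theorem bddAbove_range_lossQ {W : Set (S × A → ℝ)} {CW : ℝ}
    (hW : ∀ w ∈ W, ∀ x, 0 ≤ w x ∧ w x ≤ CW) (b q : S × A → ℝ) :
    BddAbove (Set.range fun w : W => lossQ M Pte Ptr π μ w b q) := by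
  refine ⟨∑ x, CW * |lossCoeff M Pte Ptr π μ b q x|, ?_⟩
  rintro _ ⟨w, rfl⟩
  simp only [lossQ_eq]
  refine (Finset.abs_sum_le_sum_abs _ _).trans (Finset.sum_le_sum fun x _ => ?_)
  rw [abs_mul, abs_of_nonneg (hW w w.2 x).1]
  exact mul_le_mul_of_nonneg_right (hW w w.2 x).2 (abs_nonneg _)

/-- A bound on the loss over `W` extends to the convex hull. -/
theorem lossQ_le_of_mem_convexHull {W : Set (S × A → ℝ)} {b q w : S × A → ℝ} {s : ℝ}
    (hw : w ∈ convexHull ℝ W) (h : ∀ w ∈ W, lossQ M Pte Ptr π μ w b q ≤ s) :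
    lossQ M Pte Ptr π μ w b q ≤ s := by
  refine convexHull_min (t := {w | lossQ M Pte Ptr π μ w b q ≤ s}) h ?_ hw
  intro w₁ h₁ w₂ h₂ a₁ a₂ ha₁ ha₂ ha
  simp only [Set.mem_ofPred_eq, lossQ_eq] at h₁ h₂ ⊢
  have hlin : ∑ x, (a₁ • w₁ + a₂ • w₂) x * lossCoeff M Pte Ptr π μ b q x
      = a₁ * ∑ x, w₁ x * lossCoeff M Pte Ptr π μ b q x
        + a₂ * ∑ x, w₂ x * lossCoeff M Pte Ptr π μ b q x := by
    rw [Finset.mul_sum, Finset.mul_sum, ← Finset.sum_add_distrib]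
    refine Finset.sum_congr rfl fun x _ => ?_
    simp only [Pi.add_apply, Pi.smul_apply, smul_eq_mul]
    ring
  rw [hlin]
  calc _ ≤ a₁ * |∑ x, w₁ x * lossCoeff M Pte Ptr π μ b q x|
          + a₂ * |∑ x, w₂ x * lossCoeff M Pte Ptr π μ b q x| := by
        refine (abs_add_le _ _).trans_eq ?_
        rw [abs_mul, abs_mul, abs_of_nonneg ha₁, abs_of_nonneg ha₂]
    _ ≤ a₁ * s + a₂ * s := by gcongr
    _ = s := by rw [← add_mul, ha, one_mul]

/-- At the true ratios, the loss of `q` is its evaluation error. -/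
theorem lossQ_weightRatio (hμ : ∀ x, μ x ≠ 0) (hocc : ∀ x, occ M Ptr π x ≠ 0) (q : S × A → ℝ) :
    lossQ M Pte Ptr π μ (weightRatio M Pte Ptr π) (betaRatio M Ptr π μ) q
      = |(1 - M.γ) * initialValue M π q - J M Pte π| := by
  rw [lossQ_eq, ← sum_occ_mul_td M Pte π q, J, ← Finset.sum_sub_distrib]
  congr 1
  refine Finset.sum_congr rfl fun x _ => ?_
  have h1 : weightRatio M Pte Ptr π x * occ M Ptr π x = occ M Pte π x :=
    div_mul_cancel₀ _ (hocc x)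
  rw [lossCoeff, ← mul_assoc (μ x).toReal, mass_mul_betaRatio M Ptr π hμ, ← mul_sub, ← mul_assoc,
    h1, mul_sub]

/-- On a finite space the deviation is the integral of `g` against the signed measure "empirical
minus true", so it is linear in the values of `g`. -/
theorem average_sub_integral_eq_sum {E : Type*} [Fintype E] [MeasurableSpace E]
    [MeasurableSingletonClass E] [DecidableEq E] (ν : Measure E) [IsFiniteMeasure ν] (g : E → ℝ)
    (z : Fin n → E) :
    (n : ℝ)⁻¹ * ∑ i, g (z i) - ∫ e, g e ∂ν
      = ∑ e, g e * ((n : ℝ)⁻¹ * (∑ i, if z i = e then 1 else 0) - ν.real {e}) := by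
  have h1 : ∑ i, g (z i) = ∑ e, g e * ∑ i, (if z i = e then (1 : ℝ) else 0) := by
    simp only [Finset.mul_sum]
    rw [Finset.sum_comm]
    exact Finset.sum_congr rfl fun i _ => by simp
  rw [integral_fintype .of_finite, h1, Finset.mul_sum, ← Finset.sum_sub_distrib]
  refine Finset.sum_congr rfl fun e _ => ?_
  rw [smul_eq_mul]
  ring

/-- Deviations of `β` on rectangles control the deviation of the temporal difference term. -/
theorem abs_average_tdTerm_sub_integral_le [DecidableEq S] [DecidableEq A]
    {ν : Measure ((S × A) × S)} [IsFiniteMeasure ν]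
    {w b q : S × A → ℝ} {CW CQ B t : ℝ} (hw : ∀ x, 0 ≤ w x ∧ w x ≤ CW)
    (hq : ∀ x, 0 ≤ q x ∧ q x ≤ CQ) (hCW : 0 ≤ CW) (hCQ : 0 ≤ CQ) (hB : 0 < B)
    (T : Fin n → (S × A) × S)
    (hT : ∀ (U : Finset (S × A)) (U' : Finset S),
      |(n : ℝ)⁻¹ * ∑ i, (if (T i).1 ∈ U ∧ (T i).2 ∈ U' then b (T i).1 / B else 0)
        - ∫ z, (if z.1 ∈ U ∧ z.2 ∈ U' then b z.1 / B else 0) ∂ν| ≤ t) :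
    |(n : ℝ)⁻¹ * ∑ i, tdTerm M π w b q (T i) - ∫ z, tdTerm M π w b q z ∂ν|
      ≤ 2 * (CW * CQ * B * t) := by
  set κ : S × A → S → ℝ := fun x s => b x / B *
    ((n : ℝ)⁻¹ * (∑ i, if T i = (x, s) then 1 else 0) - ν.real {(x, s)}) with hκ
  have hrect : ∀ (U : Finset (S × A)) (U' : Finset S), |∑ x ∈ U, ∑ s ∈ U', κ x s| ≤ t := by
    intro U U'
    refine le_trans (le_of_eq ?_) (hT U U')
    rw [average_sub_integral_eq_sum ν
      (fun z => if z.1 ∈ U ∧ z.2 ∈ U' then b z.1 / B else 0) T, Fintype.sum_prod_type,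
      ← Finset.sum_product', Finset.sum_product]
    congr 1
    rw [← Finset.sum_subset (Finset.subset_univ U)
      (fun x _ hx => Finset.sum_eq_zero fun s _ => by simp [hx])]
    refine Finset.sum_congr rfl fun x hx => ?_
    rw [← Finset.sum_subset (Finset.subset_univ U')
      (fun s _ hs => by simp [hs])]
    exact Finset.sum_congr rfl fun s hs => by simp [hx, hs, hκ]
  have hv := underPolicy_mem_Icc π hq
  -- The `q(s,a)` part does not depend on the next state: take `w q` as the first factor and the
  -- constant `1` as the second. The `q(s',π)` part has the factors `w` and `underPolicy π q`. One
  -- bound for each part produces the factor 2.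
  have h1 : |∑ x, ∑ s, (w x * q x) * 1 * κ x s| ≤ CW * CQ * 1 * t :=
    abs_sum_sum_mul_le_of_forall_finset (C := CW * CQ) (C' := 1) (w := fun x => w x * q x)
      (v := fun _ => 1) hrect
      (fun x => ⟨mul_nonneg (hw x).1 (hq x).1, mul_le_mul (hw x).2 (hq x).2 (hq x).1 hCW⟩)
      (fun _ => ⟨zero_le_one, le_rfl⟩) (mul_nonneg hCW hCQ) zero_le_one
  have h2 : |∑ x, ∑ s, w x * underPolicy π q s * κ x s| ≤ CW * CQ * t :=
    abs_sum_sum_mul_le_of_forall_finset hrect hw hv hCW hCQ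
  have heq : (n : ℝ)⁻¹ * ∑ i, tdTerm M π w b q (T i) - ∫ z, tdTerm M π w b q z ∂ν
      = B * (∑ x, ∑ s, (w x * q x) * 1 * κ x s
        - M.γ * ∑ x, ∑ s, w x * underPolicy π q s * κ x s) := by
    rw [average_sub_integral_eq_sum, Fintype.sum_prod_type]
    simp only [Finset.mul_sum, ← Finset.sum_sub_distrib]
    refine Finset.sum_congr rfl fun x _ => Finset.sum_congr rfl fun s _ => ?_
    simp only [hκ, tdTerm, Finset.mul_sum]
    generalize (∑ i, (n : ℝ)⁻¹ * if T i = (x, s) then (1 : ℝ) else 0) - ν.real {(x, s)} = k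
    field_simp
  rw [heq, abs_mul, abs_of_pos hB]
  have h3 : |M.γ * ∑ x, ∑ s, w x * underPolicy π q s * κ x s| ≤ CW * CQ * t := by
    rw [abs_mul, abs_of_nonneg M.γ_nonneg]
    exact (mul_le_of_le_one_left (abs_nonneg _) M.γ_lt_one.le).trans h2
  calc _ ≤ B * (CW * CQ * 1 * t + CW * CQ * t) := by
        gcongr
        exact (abs_sub _ _).trans (add_le_add h1 h3)
    _ = _ := by ring

/-- Deviations of the reward on subsets control the deviation of the weighted reward. -/
theorem abs_average_reward_sub_integral_le [DecidableEq S] [DecidableEq A] {w : S × A → ℝ} {CW t : ℝ}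
    (hw : ∀ x, 0 ≤ w x ∧ w x ≤ CW) (hCW : 0 ≤ CW) (hR : 0 < M.Rmax) (G : Fin n → (S × A) × ℝ)
    (hG : ∀ U : Finset (S × A),
      |(n : ℝ)⁻¹ * ∑ i, (if (G i).1 ∈ U then 1 / M.Rmax else 0) * (G i).2
        - ∫ y, (if y.1 ∈ U then 1 / M.Rmax else 0) * y.2 ∂(occRewardLaw M Ptr π)| ≤ t) :
    |(n : ℝ)⁻¹ * ∑ i, w (G i).1 * (G i).2 - ∫ y, w y.1 * y.2 ∂(occRewardLaw M Ptr π)|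
      ≤ CW * M.Rmax * t := by
  set κ : S × A → ℝ := fun x => (n : ℝ)⁻¹ * (∑ i, if (G i).1 = x then (G i).2 else 0)
    - occ M Ptr π x * ∫ r, r ∂(M.R x) with hκ
  have heq : ∀ f : S × A → ℝ, (n : ℝ)⁻¹ * ∑ i, f (G i).1 * (G i).2
      - ∫ y, f y.1 * y.2 ∂(occRewardLaw M Ptr π) = ∑ x, f x * κ x := by
    intro f
    have h1 : ∑ i, f (G i).1 * (G i).2 = ∑ x, f x * ∑ i, (if (G i).1 = x then (G i).2 else 0) := by
      simp only [Finset.mul_sum]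
      rw [Finset.sum_comm]
      exact Finset.sum_congr rfl fun i _ => by simp
    rw [integral_occRewardLaw, h1, Finset.mul_sum, ← Finset.sum_sub_distrib]
    refine Finset.sum_congr rfl fun x _ => ?_
    simp only [hκ]
    ring
  have hsub : ∀ U : Finset (S × A), |∑ x ∈ U, κ x| ≤ M.Rmax * t := by
    intro U
    have h := hG U
    rw [heq fun x => if x ∈ U then 1 / M.Rmax else 0] at h
    have h2 : ∑ x, (if x ∈ U then 1 / M.Rmax else 0) * κ x = 1 / M.Rmax * ∑ x ∈ U, κ x := by
      rw [Finset.mul_sum, ← Finset.sum_subset (Finset.subset_univ U)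
        (fun x _ hx => by simp [hx])]
      exact Finset.sum_congr rfl fun x hx => by simp [hx]
    rw [h2, abs_mul, abs_of_pos (by positivity), one_div, inv_mul_le_iff₀ hR] at h
    exact h
  rw [heq w, mul_assoc]
  exact abs_sum_mul_le_of_forall_finset hsub hw hCW

end Loss

/-! ### Constants of the error bound -/

section Constants

variable {S A : Type*} [Fintype S] [Fintype A]

theorem le_iSup_of_finite {ι : Type*} [Finite ι] (f : ι → ℝ) (i : ι) : f i ≤ ⨆ j, f j :=
  le_ciSup (Set.finite_range f).bddAbove i

/-- The number of pairs is the `μ`-mean of `1/μ`. This is how the factor `K` of the final bound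
absorbs the size of the union bound. -/
theorem card_le_iSup_inv (μ : PMF (S × A)) (hμ : ∀ x, μ x ≠ 0) :
    (Fintype.card (S × A) : ℝ) ≤ ⨆ x, ((μ x).toReal)⁻¹ := by
  calc (Fintype.card (S × A) : ℝ) = ∑ x, (μ x).toReal * ((μ x).toReal)⁻¹ := by
        rw [Finset.sum_congr rfl fun x _ => mul_inv_cancel₀
          (ENNReal.toReal_ne_zero.2 ⟨hμ x, μ.apply_ne_top x⟩)]
        simp
    _ ≤ ∑ x, (μ x).toReal * ⨆ x, ((μ x).toReal)⁻¹ := Finset.sum_le_sum fun x _ =>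
        mul_le_mul_of_nonneg_left (le_iSup_of_finite (fun x => ((μ x).toReal)⁻¹) x)
          ENNReal.toReal_nonneg
    _ = _ := by rw [← Finset.sum_mul, sum_pmf_toReal, one_mul]

/-- The ratio has mean one under `μ`, so its maximum is at least one. -/
theorem one_le_iSup_betaRatio (M : Env S A) (P : S → A → PMF S) (π : S → PMF A)
    {μ : PMF (S × A)} (hμ : ∀ x, μ x ≠ 0) : 1 ≤ ⨆ x, betaRatio M P π μ x := by
  calc (1 : ℝ) = ∑ x, (μ x).toReal * betaRatio M P π μ x := by
        rw [← sum_occ M P π]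
        exact Finset.sum_congr rfl fun x _ => (mass_mul_betaRatio M P π hμ x).symm
    _ ≤ ∑ x, (μ x).toReal * ⨆ x, betaRatio M P π μ x := Finset.sum_le_sum fun x _ =>
        mul_le_mul_of_nonneg_left (le_iSup_of_finite _ x) ENNReal.toReal_nonneg
    _ = _ := by rw [← Finset.sum_mul, sum_pmf_toReal, one_mul]

theorem le_classConst {Cmin Cmax : ℝ} (h : 1 ≤ Cmax) : Cmax ≤ classConst Cmin Cmax :=
  le_add_of_nonneg_right ((Real.log_nonneg h).trans (le_max_left _ _))

variable [MeasurableSpace S] [MeasurableSpace A]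

/-- Discards the complexity of the temporal difference class and the explicit deviation term, using
only that they are nonnegative. -/
theorem le_errorBound (M : Env S A) (Pte Ptr : S → A → PMF S) (π : S → PMF A) (μ : PMF (S × A))
    (F W Q : Set (S × A → ℝ)) {CW Cmin Cmax δ c rad : ℝ} (n : ℕ) (hCW : 0 ≤ CW)
    (hV : 0 ≤ M.Rmax / (1 - M.γ)) (hrad : 0 ≤ rad) :
    (⨅ q : Q, ⨆ w : W, lossQ M Pte Ptr π μ w (betaRatio M Ptr π μ) q)
      + CW * (M.Rmax / (1 - M.γ)) *
        (c * √((⨆ x, ((μ x).toReal)⁻¹) * ((⨆ x, betaRatio M Ptr π μ x) *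
          (4 * expRademacher n (ratioClass F) (μ.toMeasure.prod (occLaw M Ptr π))
            + classConst Cmin Cmax * √(2 * Real.log (2 / δ) / n)))))
      ≤ errorBound M Pte Ptr π μ F W Q CW Cmin Cmax δ n c rad := by
  have h : 0 ≤ 2 * CW * (M.Rmax / (1 - M.γ)) * √(Real.log (2 / δ) / (2 * n)) := by positivity
  unfold errorBound
  linarith

end Constants

/-! ### Evaluation error on the event where the samples concentrate -/

section Comparison

variable {S A : Type*} [Fintype S] [Fintype A] (M : Env S A) (Pte Ptr : S → A → PMF S)
  (π : S → PMF A) {μ : PMF (S × A)} {W Q : Set (S × A → ℝ)} {CW CQ : ℝ} {n : ℕ}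

/-- Both the normalized value of `q` and the return lie in `[0, Rmax]`. This settles the cases `Rmax
= 0` and `θ ≥ 1`. -/
theorem abs_value_error_le_Rmax [Nonempty (S × A)] {q : S × A → ℝ}
    (hq : ∀ x, 0 ≤ q x ∧ q x ≤ CQ) (hCQ : CQ ≤ M.Rmax / (1 - M.γ)) :
    |(1 - M.γ) * initialValue M π q - J M Pte π| ≤ M.Rmax := by
  have hγ : 0 < 1 - M.γ := sub_pos.2 M.γ_lt_one
  have h1 := initialValue_mem_Icc M π hq
  have h2 := J_mem_Icc M Pte π
  have h3 : (1 - M.γ) * initialValue M π q ≤ M.Rmax := by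
    have := (le_div_iff₀ hγ).1 (h1.2.trans hCQ)
    linarith
  have h4 : 0 ≤ (1 - M.γ) * initialValue M π q := mul_nonneg hγ.le h1.1
  exact abs_le.2 ⟨by linarith, by linarith⟩

variable [MeasurableSpace S] [MeasurableSpace A] [MeasurableSingletonClass S]
  [MeasurableSingletonClass A]

/-- If the empirical loss is uniformly `ε`-close to the population loss at the true ratio, its
minimax solution has an evaluation error at most `2 ε` above the minimax population loss. -/
theorem abs_value_error_le_of_uniform (hμ : ∀ x, μ x ≠ 0) (hocc : ∀ x, occ M Ptr π x ≠ 0)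
    (hW : ∀ w ∈ W, ∀ x, 0 ≤ w x ∧ w x ≤ CW) (hw : weightRatio M Pte Ptr π ∈ convexHull ℝ W)
    {T : Fin n → (S × A) × S} {G : Fin n → (S × A) × ℝ} {bhat qhat : S × A → ℝ} (hqhat : qhat ∈ Q)
    (hopt : ∀ q ∈ Q, (⨆ w : W, lossQEmp M π T G w bhat qhat) ≤ ⨆ w : W, lossQEmp M π T G w bhat q)
    {ε : ℝ} (hε : ∀ w ∈ W, ∀ q ∈ Q,
      |lossQEmp M π T G w bhat q - lossQ M Pte Ptr π μ w (betaRatio M Ptr π μ) q| ≤ ε) :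
    |(1 - M.γ) * initialValue M π qhat - J M Pte π|
      ≤ (⨅ q : Q, ⨆ w : W, lossQ M Pte Ptr π μ w (betaRatio M Ptr π μ) q) + 2 * ε := by
  have : Nonempty Q := ⟨⟨qhat, hqhat⟩⟩
  have : Nonempty W := (convexHull_nonempty_iff.1 ⟨_, hw⟩).to_subtype
  have hbdd := bddAbove_range_lossQ M Pte Ptr π μ hW (betaRatio M Ptr π μ)
  have hle : ∀ q ∈ Q, ∀ w : W, lossQEmp M π T G w bhat q
      ≤ (⨆ w : W, lossQ M Pte Ptr π μ w (betaRatio M Ptr π μ) q) + ε := fun q hq w => by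
    have h1 := (abs_le.1 (hε w w.2 q hq)).2
    have h2 := le_ciSup (hbdd q) w
    linarith
  rw [← lossQ_weightRatio M Pte Ptr π μ hμ hocc, ← sub_le_iff_le_add]
  refine le_ciInf fun q => ?_
  rw [sub_le_iff_le_add]
  refine lossQ_le_of_mem_convexHull M Pte Ptr π μ hw fun w hwW => ?_
  have h1 := (abs_le.1 (hε w hwW qhat hqhat)).1
  -- A real supremum takes the value `0` on an unbounded family, so boundedness is needed here; it
  -- comes from the `ε`-closeness to the bounded population loss.
  have h2 : lossQEmp M π T G w bhat qhat ≤ ⨆ w : W, lossQEmp M π T G w bhat qhat :=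
    le_ciSup (f := fun w : W => lossQEmp M π T G w bhat qhat)
      ⟨_, by rintro _ ⟨w, rfl⟩; exact hle qhat hqhat w⟩ ⟨w, hwW⟩
  have h3 := hopt q q.2
  have h4 : (⨆ w : W, lossQEmp M π T G w bhat q) ≤ _ := ciSup_le (hle q q.2)
  linarith

/-- Uniform closeness of the empirical and the population loss. -/
theorem abs_lossQEmp_sub_lossQ_le [DecidableEq S] [DecidableEq A] {w bhat b q : S × A → ℝ}
    {B V t ε : ℝ} (hn : 0 < n) (hw : ∀ x, 0 ≤ w x ∧ w x ≤ CW) (hq : ∀ x, 0 ≤ q x ∧ q x ≤ CQ)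
    (hCW : 0 ≤ CW) (hCQ : 0 ≤ CQ) (hCQV : CQ ≤ V) (hR : 0 < M.Rmax) (hRV : M.Rmax ≤ V)
    (hB : 1 ≤ B) (ht : 0 ≤ t) (hε : 0 ≤ ε) (hb : ∀ x, |bhat x - b x| ≤ ε)
    (T : Fin n → (S × A) × S) (G : Fin n → (S × A) × ℝ)
    (hT : ∀ (U : Finset (S × A)) (U' : Finset S),
      |(n : ℝ)⁻¹ * ∑ i, (if (T i).1 ∈ U ∧ (T i).2 ∈ U' then b (T i).1 / B else 0)
        - ∫ z, (if z.1 ∈ U ∧ z.2 ∈ U' then b z.1 / B else 0) ∂(transitionLaw Pte μ)| ≤ t)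
    (hG : ∀ U : Finset (S × A),
      |(n : ℝ)⁻¹ * ∑ i, (if (G i).1 ∈ U then 1 / M.Rmax else 0) * (G i).2
        - ∫ y, (if y.1 ∈ U then 1 / M.Rmax else 0) * y.2 ∂(occRewardLaw M Ptr π)| ≤ t) :
    |lossQEmp M π T G w bhat q - lossQ M Pte Ptr π μ w b q| ≤ CW * V * (3 * (B * t) + ε) := by
  have h1 := abs_average_tdTerm_sub_le M π hn hw hq hb hCW T
  have h2 := abs_average_tdTerm_sub_integral_le M π hw hq hCW hCQ (zero_lt_one.trans_le hB) T hT
  have h3 := abs_average_reward_sub_integral_le M Ptr π hw hCW hR G hG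
  have h4 : CW * ε * CQ ≤ CW * V * ε := by nlinarith [mul_nonneg hCW hε]
  have h5 : CW * CQ * B * t ≤ CW * V * (B * t) := by
    rw [mul_assoc (CW * CQ)]
    exact mul_le_mul_of_nonneg_right (mul_le_mul_of_nonneg_left hCQV hCW) (by positivity)
  have h6 : CW * M.Rmax * t ≤ CW * V * (B * t) :=
    mul_le_mul (mul_le_mul_of_nonneg_left hRV hCW) (le_mul_of_one_le_left ht hB) ht
      (mul_nonneg hCW (hR.le.trans hRV))
  unfold lossQEmp lossQ
  -- Once the outer absolute values are removed, the error of the ratio contributes `ε`, the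
  -- temporal difference term `2 B t` and the reward `B t`, each times `CW V`.
  refine (abs_abs_sub_abs_le_abs_sub _ _).trans ?_
  rw [abs_le] at h1 h2 h3 ⊢
  constructor <;> linarith [h1.1, h1.2, h2.1, h2.2, h3.1, h3.2]

end Comparison

/-! ### Probability of the concentration events -/

section Events

variable {S A : Type*} [Fintype S] [Fintype A] [MeasurableSpace S] [MeasurableSpace A]
  [MeasurableSingletonClass S] [MeasurableSingletonClass A] [DecidableEq S] [DecidableEq A]
  (M : Env S A) (P : S → A → PMF S) (π : S → PMF A) {n : ℕ}
  {Ω : Type*} [MeasurableSpace Ω] {Pr : Measure Ω} [IsProbabilityMeasure Pr]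

theorem measure_exists_transition_deviation_le {ν : Measure ((S × A) × S)} {b : S × A → ℝ}
    {B : ℝ} (hB : 0 < B) (hb : ∀ x, 0 ≤ b x ∧ b x ≤ B) (hn : 0 < n) {T : Fin n → Ω → (S × A) × S}
    (hindep : iIndepFun T Pr) (hlaw : ∀ i, HasLaw (T i) ν Pr) {t : ℝ} (ht : 0 ≤ t) :
    Pr {ω | ∃ (U : Finset (S × A)) (U' : Finset S), t <
      |(n : ℝ)⁻¹ * ∑ i, (if (T i ω).1 ∈ U ∧ (T i ω).2 ∈ U' then b (T i ω).1 / B else 0)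
        - ∫ z, (if z.1 ∈ U ∧ z.2 ∈ U' then b z.1 / B else 0) ∂ν|}
      ≤ ENNReal.ofReal (2 * (2 ^ Fintype.card (S × A) * 2 ^ Fintype.card S)
          * Real.exp (-(2 * n * t ^ 2))) := by
  have h := measure_exists_abs_average_sub_gt_le ν
    (h := fun (j : Finset (S × A) × Finset S) z =>
      if z.1 ∈ j.1 ∧ z.2 ∈ j.2 then b z.1 / B else 0)
    (fun _ => .of_discrete) (fun j => ae_of_all _ fun z => by
      have h1 : 0 ≤ b z.1 / B := div_nonneg (hb z.1).1 hB.le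
      have h2 : b z.1 / B ≤ 1 := (div_le_one hB).2 (hb z.1).2
      split_ifs
      · exact ⟨h1, h2⟩
      · exact ⟨le_rfl, zero_le_one⟩) hn hindep hlaw ht
  refine le_trans (measure_mono ?_) (h.trans_eq ?_)
  · rintro ω ⟨U, U', hω⟩
    exact ⟨(U, U'), hω⟩
  · rw [Fintype.card_prod, Fintype.card_finset, Fintype.card_finset]
    push_cast
    rfl

theorem measure_exists_reward_deviation_le (hR : 0 < M.Rmax) (hn : 0 < n)
    {G : Fin n → Ω → (S × A) × ℝ} (hindep : iIndepFun G Pr)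
    (hlaw : ∀ i, HasLaw (G i) (occRewardLaw M P π) Pr) {t : ℝ} (ht : 0 ≤ t) :
    Pr {ω | ∃ U : Finset (S × A), t <
      |(n : ℝ)⁻¹ * ∑ i, (if (G i ω).1 ∈ U then 1 / M.Rmax else 0) * (G i ω).2
        - ∫ y, (if y.1 ∈ U then 1 / M.Rmax else 0) * y.2 ∂(occRewardLaw M P π)|}
      ≤ ENNReal.ofReal (2 * 2 ^ Fintype.card (S × A) * Real.exp (-(2 * n * t ^ 2))) := by
  have h := measure_exists_abs_average_sub_gt_le (occRewardLaw M P π)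
    (h := fun (U : Finset (S × A)) y => (if y.1 ∈ U then 1 / M.Rmax else 0) * y.2)
    (fun U => ((Measurable.of_discrete
      (f := fun x : S × A => if x ∈ U then 1 / M.Rmax else 0)).comp measurable_fst).mul
        measurable_snd)
    (fun U => (occRewardLaw_reward_mem_Icc M P π).mono fun y hy => by
      split_ifs
      · refine ⟨mul_nonneg (by positivity) hy.1, ?_⟩
        rw [one_div, inv_mul_le_one₀ hR]
        exact hy.2
      · simp) hn hindep hlaw ht
  refine h.trans_eq ?_
  rw [Fintype.card_finset]
  push_cast
  rfl

/-- The failure probabilities of both families of deviations, at the level used in the bound. -/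
theorem exp_count_le {N s n K L : ℝ} (hs : s ≤ N) (hN : 1 ≤ N) (hK : N ≤ K)
    (hL : Real.log 2 ≤ L) (hn : 0 < n) :
    2 * (2 ^ N * 2 ^ s) * Real.exp (-(2 * n * √(3 * K * L / n) ^ 2))
      + 2 * 2 ^ N * Real.exp (-(2 * n * √(3 * K * L / n) ^ 2)) ≤ Real.exp (-L) := by
  have hlog : 0 < Real.log 2 := Real.log_pos one_lt_two
  have hL0 : 0 < L := hlog.trans_le hL
  have hK1 : 1 ≤ K := hN.trans hK
  rw [Real.sq_sqrt (by positivity), show 2 * n * (3 * K * L / n) = 6 * K * L by field_simp; ring]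
  have h1 : (2 : ℝ) ^ s ≤ 2 ^ N := Real.rpow_le_rpow_of_exponent_le one_le_two hs
  have h2 : (1 : ℝ) ≤ 2 ^ N := Real.one_le_rpow one_le_two (by linarith)
  have h3 : (2 : ℝ) ^ N = Real.exp (Real.log 2 * N) := Real.rpow_def_of_pos two_pos N
  have h4 : Real.exp (Real.log 2) = 2 := Real.exp_log two_pos
  calc _ ≤ 2 * (2 ^ N * 2 ^ N) * Real.exp (-(6 * K * L))
          + 2 * (2 ^ N * 2 ^ N) * Real.exp (-(6 * K * L)) := by
        gcongr
        exact le_mul_of_one_le_left (by positivity) h2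
    _ = 2 * 2 * (2 ^ N * 2 ^ N) * Real.exp (-(6 * K * L)) := by ring
    _ = Real.exp (2 * Real.log 2 + 2 * (Real.log 2 * N) - 6 * K * L) := by
        have h5 : Real.exp (2 * Real.log 2 + 2 * (Real.log 2 * N) - 6 * K * L)
            = Real.exp (Real.log 2) * Real.exp (Real.log 2)
              * (Real.exp (Real.log 2 * N) * Real.exp (Real.log 2 * N))
              * Real.exp (-(6 * K * L)) := by
          simp only [← Real.exp_add]
          congr 1
          ring
        rw [h5, h4, h3]
    _ ≤ Real.exp (-L) := by
        -- The number of events costs at most `2L + 2KL ≤ 4KL`, leaving at most `-2KL ≤ -L`. The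
        -- factor 3 in the deviation level provides this room.
        refine Real.exp_le_exp.2 ?_
        have h5 : Real.log 2 * N ≤ L * K := mul_le_mul hL hK (by linarith) hL0.le
        have h6 : L ≤ L * K := le_mul_of_one_le_right hL0.le hK1
        nlinarith

end Events

/-! ### Assembly: the deterministic bound with its constants, and the union bound -/

section Main

variable {S A : Type*} [Fintype S] [Fintype A] [MeasurableSpace S] [MeasurableSpace A]
  [MeasurableSingletonClass S] [MeasurableSingletonClass A] [DecidableEq S] [DecidableEq A]

/-- The evaluation error when the two samples concentrate: `h₁` for the density ratio estimator,
`h₂` and `h₃` for the transitions and the rewards. -/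
theorem abs_value_error_le_of_concentration [Nonempty (S × A)] (M : Env S A)
    (Pte Ptr : S → A → PMF S) (π : S → PMF A) {μ : PMF (S × A)} (hμ : ∀ x, μ x ≠ 0)
    {F W Q : Set (S × A → ℝ)} {Cmin Cmax CW CQ : ℝ} (hCmin : 0 < Cmin)
    (hF : ∀ f ∈ F, ∀ x, Cmin ≤ f x ∧ f x ≤ Cmax) (hW : ∀ w ∈ W, ∀ x, 0 ≤ w x ∧ w x ≤ CW)
    (hQ : ∀ q ∈ Q, ∀ x, 0 ≤ q x ∧ q x ≤ CQ) (hCQV : CQ ≤ M.Rmax / (1 - M.γ))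
    (hβF : betaRatio M Ptr π μ ∈ F) (hocc : ∀ x, occ M Ptr π x ≠ 0)
    (hwW : weightRatio M Pte Ptr π ∈ convexHull ℝ W) {n : ℕ} (hn : 0 < n)
    {X Y : Fin n → S × A} {T : Fin n → (S × A) × S} {G : Fin n → (S × A) × ℝ}
    {bhat qhat : S × A → ℝ}
    (hbhat : bhat ∈ F ∧ ∀ f ∈ F, ratioObjective X Y f ≤ ratioObjective X Y bhat)
    (hqhat : qhat ∈ Q ∧ ∀ q ∈ Q,
      (⨆ w : W, lossQEmp M π T G w bhat qhat) ≤ ⨆ w : W, lossQEmp M π T G w bhat q)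
    {B K L CF ER : ℝ} (hB : 1 ≤ B) (hβB : ∀ x, betaRatio M Ptr π μ x ≤ B) (hK1 : 1 ≤ K)
    (hK : ∀ x, ((μ x).toReal)⁻¹ ≤ K) (hL0 : 0 < L) (hBF : B ≤ CF) (hER0 : 0 ≤ ER)
    (h₁ : supDeviation (ratioClass F) (μ.toMeasure.prod (occLaw M Ptr π)) (fun i => (X i, Y i))
      + ((n : ℝ)⁻¹ * ∑ i, (betaRatio M Ptr π μ (X i) - Real.log (betaRatio M Ptr π μ (Y i)))
        - ∫ p, (betaRatio M Ptr π μ p.1 - Real.log (betaRatio M Ptr π μ p.2))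
            ∂(μ.toMeasure.prod (occLaw M Ptr π)))
      ≤ 2 * ER + 4 * CF * √(2 * L / n))
    (h₂ : 0 < M.Rmax → ∀ (U : Finset (S × A)) (U' : Finset S),
      |(n : ℝ)⁻¹ * ∑ i, (if (T i).1 ∈ U ∧ (T i).2 ∈ U' then betaRatio M Ptr π μ (T i).1 / B else 0)
        - ∫ z, (if z.1 ∈ U ∧ z.2 ∈ U' then betaRatio M Ptr π μ z.1 / B else 0)
            ∂(transitionLaw Pte μ)| ≤ √(3 * K * L / n))
    (h₃ : 0 < M.Rmax → ∀ U : Finset (S × A),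
      |(n : ℝ)⁻¹ * ∑ i, (if (G i).1 ∈ U then 1 / M.Rmax else 0) * (G i).2
        - ∫ y, (if y.1 ∈ U then 1 / M.Rmax else 0) * y.2 ∂(occRewardLaw M Ptr π)|
      ≤ √(3 * K * L / n)) :
    |(1 - M.γ) * initialValue M π qhat - J M Pte π|
      ≤ (⨅ q : Q, ⨆ w : W, lossQ M Pte Ptr π μ w (betaRatio M Ptr π μ) q)
        + CW * (M.Rmax / (1 - M.γ)) *
          (28 * √(K * (B * (4 * ER + CF * √(2 * L / n))))) := by
  obtain ⟨hβω, hβopt⟩ := hbhat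
  obtain ⟨hqω, hqopt⟩ := hqhat
  obtain ⟨x₀⟩ : Nonempty (S × A) := inferInstance
  set β := betaRatio M Ptr π μ with hβ
  have hβpos : ∀ x, 0 < β x := fun x => hCmin.trans_le (hF β hβF x).1
  have hγ : 0 < 1 - M.γ := sub_pos.2 M.γ_lt_one
  have hR0 : 0 ≤ M.Rmax := M.Rmax_nonneg
  set V := M.Rmax / (1 - M.γ) with hVdef
  have hRV : M.Rmax ≤ V := le_div_self hR0 hγ (by linarith [M.γ_nonneg])
  have hV : 0 ≤ V := hR0.trans hRV
  have hCW : 1 ≤ CW := one_le_of_weightRatio_mem_convexHull M Pte Ptr π hocc hW hwW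
  have hCW0 : 0 ≤ CW := zero_le_one.trans hCW
  have hCF0 : 0 < CF := zero_lt_one.trans_le (hB.trans hBF)
  set ν := μ.toMeasure.prod (occLaw M Ptr π) with hν
  set u := √(2 * L / n) with hu
  have hn' : (0 : ℝ) < n := by exact_mod_cast hn
  have hu0 : 0 ≤ u := Real.sqrt_nonneg _
  set Γ := 4 * ER + CF * u with hΓ
  set θ := K * (B * Γ) with hθ
  have hθ0 : 0 ≤ θ := by positivity
  set t := √(3 * K * L / n) with ht
  have ht0 : 0 ≤ t := Real.sqrt_nonneg _
  set I := ⨅ q : Q, ⨆ w : W, lossQ M Pte Ptr π μ w β q with hI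
  have hI0 : 0 ≤ I := Real.iInf_nonneg fun q => Real.iSup_nonneg fun w => abs_nonneg _
  have htriv := abs_value_error_le_Rmax M Pte π (hQ _ hqω) hCQV
  have hsθ : 0 ≤ √θ := Real.sqrt_nonneg θ
  rcases hR0.eq_or_lt with hR | hR
  · have : 0 ≤ CW * V * (28 * √θ) := by positivity
    linarith
  -- For `θ ≥ 1` the right-hand side already exceeds `V ≥ Rmax`. The remaining case has `θ < 1`,
  -- needed both for `θ ≤ √θ` and to compare the two rates.
  rcases le_or_gt 1 θ with hθ1 | hθ1
  · have hs : 1 ≤ √θ := Real.one_le_sqrt.2 hθ1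
    have : V ≤ CW * V * (28 * √θ) := by
      rw [mul_right_comm]
      exact le_mul_of_one_le_left hV (one_le_mul_of_one_le_of_one_le hCW (by linarith))
    linarith
  have hgap := (excess_risk_le_supDeviation (ν := ν) hCmin hF hn hβω (hβopt β hβF)).trans h₁
  have hβclose : ∀ x, |bhat x - β x| ≤ 8 * √θ := fun x => by
    refine abs_sub_le_of_mul_sq_sqrt_sub_le (hβpos x).le
      (hCmin.le.trans (hF _ hβω x).1) (hβB x) hB hθ1.le ?_
    have h := (mass_mul_sq_sqrt_betaRatio_sub_le M Ptr π hμ hβpos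
      (fun x => hCmin.trans_le (hF _ hβω x).1) x).trans hgap
    have hm : 0 < (μ x).toReal := ENNReal.toReal_pos (hμ x) (μ.apply_ne_top x)
    have h2 : (√(β x) - √(bhat x)) ^ 2 ≤ K * (4 * Γ) := by
      calc (√(β x) - √(bhat x)) ^ 2
          = ((μ x).toReal)⁻¹ * ((μ x).toReal * (√(β x) - √(bhat x)) ^ 2) := by
            field_simp
        _ ≤ K * (4 * Γ) := by
            refine mul_le_mul (hK x)
              (h.trans ?_) (by positivity) (by positivity)
            rw [hΓ]
            linarith
    calc B * (√(β x) - √(bhat x)) ^ 2 ≤ B * (K * (4 * Γ)) := by gcongr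
      _ = 4 * θ := by rw [hθ]; ring
  -- The Hoeffding level `t` is of order `√K u`, while `θ` contains `K B² u` because `B ≤ CF`. As `θ
  -- < 1` forces `u ≤ 1`, `(B t)² = (3/2) K B² u² ≤ (3/2) θ`.
  have hBt : B * t ≤ 2 * √θ := by
    have hθu : K * B ^ 2 * u ≤ θ := by
      calc K * B ^ 2 * u = K * (B * (B * u)) := by ring
        _ ≤ K * (B * Γ) := by
            gcongr
            calc B * u ≤ CF * u := by gcongr
              _ ≤ Γ := le_add_of_nonneg_left (by positivity)
    have hKB : 1 ≤ K * B ^ 2 := one_le_mul_of_one_le_of_one_le hK1 (one_le_pow₀ hB)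
    have hu1 : u ≤ 1 := (le_mul_of_one_le_left hu0 hKB).trans (hθu.trans hθ1.le)
    have hu2 : u ^ 2 = 2 * L / n := Real.sq_sqrt (by positivity)
    have ht2 : t ^ 2 = 3 / 2 * (K * u ^ 2) := by
      rw [hu2, ht, Real.sq_sqrt (by positivity)]
      ring
    have h4 : (B * t) ^ 2 ≤ (2 * √θ) ^ 2 := by
      rw [mul_pow, mul_pow, ht2, Real.sq_sqrt hθ0]
      have h5 : K * B ^ 2 * u ^ 2 ≤ K * B ^ 2 * u := by
        gcongr
        nlinarith
      nlinarith
    exact (pow_le_pow_iff_left₀ (by positivity) (by positivity) two_ne_zero).1 h4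
  have hCQ0 : 0 ≤ CQ := (hQ _ hqω x₀).1.trans (hQ _ hqω x₀).2
  have hmain := abs_value_error_le_of_uniform M Pte Ptr π hμ hocc hW hwW hqω hqopt
    (fun w hw q hq => abs_lossQEmp_sub_lossQ_le M Pte Ptr π hn (hW w hw) (hQ q hq) hCW0 hCQ0
      hCQV hR hRV hB ht0 (by positivity) hβclose T G (h₂ hR) (h₃ hR))
  refine hmain.trans (add_le_add_right ?_ I)
  -- Here `3 · 2 + 8 = 14`, and the factor 2 of the minimax comparison makes the constant 28.
  have h6 : CW * V * (3 * (B * t) + 8 * √θ) ≤ CW * V * (14 * √θ) := by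
    gcongr
    linarith
  linarith

end Main

end OffEnv

theorem theorem2 :
    ∃ c : ℝ, 0 < c ∧
    ∀ (S A : Type*) [Fintype S] [Fintype A] [MeasurableSpace S] [MeasurableSpace A]
      [MeasurableSingletonClass S] [MeasurableSingletonClass A]
      -- the two environments, the target policy and the data distribution
      (M : Env S A) (Pte Ptr : S → A → PMF S) (π : S → PMF A) (μ : PMF (S × A))
      (_ : ∀ x, μ x ≠ 0)
      -- bounded function classes
      (F W Q : Set (S × A → ℝ)) (Cmin Cmax CW CQ : ℝ)
      (_ : 0 < Cmin) (_ : ∀ f ∈ F, ∀ x, Cmin ≤ f x ∧ f x ≤ Cmax)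
      (_ : ∀ w ∈ W, ∀ x, 0 ≤ w x ∧ w x ≤ CW)
      (_ : ∀ q ∈ Q, ∀ x, 0 ≤ q x ∧ q x ≤ CQ) (_ : CQ ≤ M.Rmax / (1 - M.γ))
      -- realizability
      (_ : betaRatio M Ptr π μ ∈ F)
      (_ : weightRatio M Pte Ptr π ∈ convexHull ℝ W)
      (n : ℕ) (_ : 0 < n) (δ : ℝ) (_ : 0 < δ) (_ : δ < 1)
      (Ω : Type*) [MeasurableSpace Ω] (Pr : Measure Ω) [IsProbabilityMeasure Pr]
      -- the samples for the ratio estimator, `X` from `μ` and `Y` from the simulator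
      (X Y : Fin n → Ω → S × A)
      (_ : iIndepFun (fun i ω => (X i ω, Y i ω)) Pr)
      (_ : ∀ i, HasLaw (fun ω => (X i ω, Y i ω)) (μ.toMeasure.prod (occLaw M Ptr π)) Pr)
      -- the samples for the Q-function estimator; how they depend on those above is left free
      (T : Fin n → Ω → (S × A) × S) (G : Fin n → Ω → (S × A) × ℝ)
      (_ : iIndepFun (fun i ω => (T i ω, G i ω)) Pr)
      (_ : ∀ i, HasLaw (fun ω => (T i ω, G i ω))
        ((transitionLaw Pte μ).prod (occRewardLaw M Ptr π)) Pr)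
      -- the estimators
      (βhat : Ω → S × A → ℝ)
      (_ : ∀ᵐ ω ∂Pr, βhat ω ∈ F ∧ ∀ f ∈ F,
        ratioObjective (fun i => X i ω) (fun i => Y i ω) f
          ≤ ratioObjective (fun i => X i ω) (fun i => Y i ω) (βhat ω))
      (qhat : Ω → S × A → ℝ)
      (_ : ∀ᵐ ω ∂Pr, qhat ω ∈ Q ∧ ∀ q ∈ Q,
        (⨆ w : W, lossQEmp M π (fun i => T i ω) (fun i => G i ω) w (βhat ω) (qhat ω))
          ≤ ⨆ w : W, lossQEmp M π (fun i => T i ω) (fun i => G i ω) w (βhat ω) q),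
      -- with probability at least `1 - δ`, for the empirical Rademacher complexity and also for
      -- its expectation
      Pr {ω | ¬ (|(1 - M.γ) * initialValue M π (qhat ω) - J M Pte π|
            ≤ errorBound M Pte Ptr π μ F W Q CW Cmin Cmax δ n c
                (empRademacher (tdClass M π (betaRatio M Ptr π μ) W Q) (fun i => T i ω))
          ∧ |(1 - M.γ) * initialValue M π (qhat ω) - J M Pte π|
            ≤ errorBound M Pte Ptr π μ F W Q CW Cmin Cmax δ n c
                (expRademacher n (tdClass M π (betaRatio M Ptr π μ) W Q)
                  (transitionLaw Pte μ)))}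
        ≤ ENNReal.ofReal δ := by
  classical
  refine ⟨28, by norm_num, ?_⟩
  intro S A _ _ _ _ _ _ M Pte Ptr π μ hμ F W Q Cmin Cmax CW CQ hCmin hF hW hQ hCQV hβF hwW n hn δ
    hδ hδ1 Ω _ Pr _ X Y hXYindep hXYlaw T G hTGindep hTGlaw βhat hβhat qhat hqhat
  -- A probability distribution has a point of positive mass, so the finite spaces are nonempty.
  obtain ⟨s₀, -⟩ := M.d₀.support_nonempty
  obtain ⟨a₀, -⟩ := (π s₀).support_nonempty
  have : Nonempty (S × A) := ⟨(s₀, a₀)⟩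
  set L := Real.log (2 / δ) with hLdef
  have hL : Real.log 2 ≤ L := Real.log_le_log two_pos (by
    rw [le_div_iff₀ hδ]
    linarith)
  have hL0 : 0 < L := (Real.log_pos one_lt_two).trans_le hL
  have hexpL : Real.exp (-L) = δ / 2 := by
    rw [Real.exp_neg, hLdef, Real.exp_log (by positivity), inv_div]
  set β := betaRatio M Ptr π μ with hβ
  have hβpos : ∀ x, 0 < β x := fun x => hCmin.trans_le (hF β hβF x).1
  have hocc : ∀ x, occ M Ptr π x ≠ 0 := fun x h => by
    have := hβpos x
    rw [hβ, betaRatio, h, zero_div] at this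
    exact this.false
  have hγ : 0 < 1 - M.γ := sub_pos.2 M.γ_lt_one
  have hR0 : 0 ≤ M.Rmax := M.Rmax_nonneg
  set V := M.Rmax / (1 - M.γ) with hVdef
  have hRV : M.Rmax ≤ V := le_div_self hR0 hγ (by linarith [M.γ_nonneg])
  have hV : 0 ≤ V := hR0.trans hRV
  have hCW : 1 ≤ CW := one_le_of_weightRatio_mem_convexHull M Pte Ptr π hocc hW hwW
  have hCW0 : 0 ≤ CW := zero_le_one.trans hCW
  set K := ⨆ x, ((μ x).toReal)⁻¹ with hK
  set B := ⨆ x, β x with hBdef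
  have hB : 1 ≤ B := one_le_iSup_betaRatio M Ptr π hμ
  have hβB : ∀ x, β x ≤ B := le_iSup_of_finite β
  have hBC : B ≤ Cmax := ciSup_le fun x => (hF β hβF x).2
  have hBF : B ≤ classConst Cmin Cmax := hBC.trans (le_classConst (hB.trans hBC))
  have hcard : (1 : ℝ) ≤ Fintype.card (S × A) := by exact_mod_cast Fintype.card_pos
  have hNK : (Fintype.card (S × A) : ℝ) ≤ K := card_le_iSup_inv μ hμ
  have hK1 : 1 ≤ K := hcard.trans hNK
  have hSN : (Fintype.card S : ℝ) ≤ Fintype.card (S × A) := by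
    exact_mod_cast Fintype.card_le_of_injective (fun s => (s, a₀)) fun s s' h => congrArg Prod.fst h
  set ν := μ.toMeasure.prod (occLaw M Ptr π) with hν
  set CF := classConst Cmin Cmax with hCF
  have hCF0 : 0 < CF := zero_lt_one.trans_le (hB.trans hBF)
  have hratio := abs_ratioClass_le (Cmax := Cmax) hCmin hF
  set ER := expRademacher n (ratioClass F) ν with hER
  have hER0 : 0 ≤ ER := expRademacher_nonneg hratio ⟨_, β, hβF, rfl⟩ ν
  have hn' : (0 : ℝ) < n := by exact_mod_cast hn
  set t := √(3 * K * L / n) with ht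
  have ht0 : 0 ≤ t := Real.sqrt_nonneg _
  have hTindep : iIndepFun T Pr := hTGindep.comp (fun _ => Prod.fst) fun _ => measurable_fst
  have hGindep : iIndepFun G Pr := hTGindep.comp (fun _ => Prod.snd) fun _ => measurable_snd
  have hTlaw : ∀ i, HasLaw (T i) (transitionLaw Pte μ) Pr := fun i =>
    measurePreserving_fst.hasLaw.comp (hTGlaw i)
  have hGlaw : ∀ i, HasLaw (G i) (occRewardLaw M Ptr π) Pr := fun i =>
    measurePreserving_snd.hasLaw.comp (hTGlaw i)
  have hQne : ∀ ω, qhat ω ∈ Q → (tdClass M π β W Q).Nonempty := fun ω hω => by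
    obtain ⟨w, hw⟩ := convexHull_nonempty_iff.1 ⟨_, hwW⟩
    exact ⟨_, w, hw, _, hω, rfl⟩
  have htd := abs_tdClass_le M π hW hQ (b := β) (B := B)
    (fun x => (abs_of_pos (hβpos x)).trans_le (hβB x)) hCW0
  -- A bound without the Rademacher complexity of the temporal difference class suffices.
  have hreduce : ∀ ω, qhat ω ∈ Q →
      |(1 - M.γ) * initialValue M π (qhat ω) - J M Pte π| ≤ (⨅ q : Q, ⨆ w : W, lossQ M Pte Ptr π μ w β q)
        + CW * V * (28 * √(K * (B * (4 * ER + CF * √(2 * L / n))))) →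
      |(1 - M.γ) * initialValue M π (qhat ω) - J M Pte π|
          ≤ errorBound M Pte Ptr π μ F W Q CW Cmin Cmax δ n 28
              (empRademacher (tdClass M π β W Q) (fun i => T i ω))
        ∧ |(1 - M.γ) * initialValue M π (qhat ω) - J M Pte π|
          ≤ errorBound M Pte Ptr π μ F W Q CW Cmin Cmax δ n 28
              (expRademacher n (tdClass M π β W Q) (transitionLaw Pte μ)) :=
    fun ω hω h => ⟨h.trans (le_errorBound M Pte Ptr π μ F W Q n hCW0 hV
        (empRademacher_nonneg htd (hQne ω hω) _)),
      h.trans (le_errorBound M Pte Ptr π μ F W Q n hCW0 hV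
        (expRademacher_nonneg htd (hQne ω hω) _))⟩
  set bad₁ := {ω | 2 * ER + 4 * CF * √(2 * L / n) < supDeviation (ratioClass F) ν (fun i => (X i ω, Y i ω))
    + ((n : ℝ)⁻¹ * ∑ i, (β (X i ω) - Real.log (β (Y i ω)))
      - ∫ p, (β p.1 - Real.log (β p.2)) ∂ν)} with hbad₁
  set bad₂ := {ω | ∃ (U : Finset (S × A)) (U' : Finset S), t <
    |(n : ℝ)⁻¹ * ∑ i, (if (T i ω).1 ∈ U ∧ (T i ω).2 ∈ U' then β (T i ω).1 / B else 0)
      - ∫ z, (if z.1 ∈ U ∧ z.2 ∈ U' then β z.1 / B else 0) ∂(transitionLaw Pte μ)|} with hbad₂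
  set bad₃ := {ω | ∃ U : Finset (S × A), t <
    |(n : ℝ)⁻¹ * ∑ i, (if (G i ω).1 ∈ U then 1 / M.Rmax else 0) * (G i ω).2
      - ∫ y, (if y.1 ∈ U then 1 / M.Rmax else 0) * y.2 ∂(occRewardLaw M Ptr π)|} with hbad₃
  -- At level `4 CF √(2L/n)` the exponent `n t² / (32 CF²)` is exactly `L = log (2/δ)`.
  have hp₁ : Pr bad₁ ≤ ENNReal.ofReal (δ / 2) := by
    have h := measure_supDeviation_add_gt_le (Pr := Pr) hCF0 hratio
      (g₀ := fun p => β p.1 - Real.log (β p.2)) ⟨β, hβF, rfl⟩ hn ν hXYindep hXYlaw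
      (t := 4 * CF * √(2 * L / n)) (by positivity)
    refine h.trans_eq ?_
    rw [← hexpL]
    congr 2
    rw [mul_pow, Real.sq_sqrt (by positivity)]
    field_simp
    ring
  -- Rewards are divided by `Rmax` to land in `[0,1]`, hence the condition; for `Rmax = 0` the error
  -- vanishes and these events are not needed.
  have hp₂₃ : 0 < M.Rmax → Pr bad₂ + Pr bad₃ ≤ ENNReal.ofReal (δ / 2) := by
    intro hR
    have h2 := measure_exists_transition_deviation_le (Pr := Pr) (zero_lt_one.trans_le hB)
      (fun x => ⟨(hβpos x).le, hβB x⟩) hn hTindep hTlaw ht0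
    have h3 := measure_exists_reward_deviation_le (Pr := Pr) M Ptr π hR hn hGindep hGlaw ht0
    refine (add_le_add h2 h3).trans ?_
    rw [← ENNReal.ofReal_add (by positivity) (by positivity), ← hexpL]
    have h4 := exp_count_le hSN hcard hNK hL hn'
    simp only [Real.rpow_natCast] at h4
    exact ENNReal.ofReal_le_ofReal h4
  have hhalf : ENNReal.ofReal (δ / 2) + ENNReal.ofReal (δ / 2) = ENNReal.ofReal δ := by
    rw [← ENNReal.ofReal_add (by positivity) (by positivity), add_halves]
  set null : Set Ω := {ω | ¬ ((βhat ω ∈ F ∧ ∀ f ∈ F,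
        ratioObjective (fun i => X i ω) (fun i => Y i ω) f
          ≤ ratioObjective (fun i => X i ω) (fun i => Y i ω) (βhat ω)) ∧
      (qhat ω ∈ Q ∧ ∀ q ∈ Q,
        (⨆ w : W, lossQEmp M π (fun i => T i ω) (fun i => G i ω) w (βhat ω) (qhat ω))
          ≤ ⨆ w : W, lossQEmp M π (fun i => T i ω) (fun i => G i ω) w (βhat ω) q))} with hnull
  have hp₀ : Pr null = 0 := ae_iff.1 (hβhat.and hqhat)
  have hkey : ∀ ω, ω ∉ null → ω ∉ bad₁ → (0 < M.Rmax → ω ∉ bad₂) → (0 < M.Rmax → ω ∉ bad₃) →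
      |(1 - M.γ) * initialValue M π (qhat ω) - J M Pte π|
          ≤ errorBound M Pte Ptr π μ F W Q CW Cmin Cmax δ n 28
              (empRademacher (tdClass M π β W Q) (fun i => T i ω))
        ∧ |(1 - M.γ) * initialValue M π (qhat ω) - J M Pte π|
          ≤ errorBound M Pte Ptr π μ F W Q CW Cmin Cmax δ n 28
              (expRademacher n (tdClass M π β W Q) (transitionLaw Pte μ)) := by
    intro ω h₀ h₁ h₂ h₃
    simp only [hnull, hbad₁, hbad₂, hbad₃, Set.mem_ofPred_eq, not_exists, not_lt, not_not]
      at h₀ h₁ h₂ h₃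
    exact hreduce ω h₀.2.1 (abs_value_error_le_of_concentration M Pte Ptr π hμ hCmin hF hW hQ hCQV
      hβF hocc hwW hn h₀.1 h₀.2 hB hβB hK1 (le_iSup_of_finite fun x => ((μ x).toReal)⁻¹) hL0 hBF
      hER0 h₁ h₂ h₃)
  -- The failure set is covered by a null set and the bad events. Subadditivity of the outer measure
  -- suffices, so neither measurability of the estimators nor the joint law of the two samples
  -- enters.
  rcases hR0.eq_or_lt with hR | hR
  · refine (measure_mono (t := null ∪ bad₁) fun ω hω => ?_).trans ?_
    · by_contra hcon
      rw [Set.mem_union, not_or] at hcon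
      exact hω (hkey ω hcon.1 hcon.2 (fun h => absurd h hR.not_lt) fun h => absurd h hR.not_lt)
    · refine (measure_union_le _ _).trans ?_
      rw [hp₀, zero_add]
      exact hp₁.trans (ENNReal.ofReal_le_ofReal (by linarith))
  · refine (measure_mono (t := null ∪ (bad₁ ∪ (bad₂ ∪ bad₃))) fun ω hω => ?_).trans ?_
    · by_contra hcon
      simp only [Set.mem_union, not_or] at hcon
      exact hω (hkey ω hcon.1 hcon.2.1 (fun _ => hcon.2.2.1) fun _ => hcon.2.2.2)
    · refine (measure_union_le _ _).trans ?_
      rw [hp₀, zero_add, ← hhalf]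
      exact (measure_union_le _ _).trans
        (add_le_add hp₁ ((measure_union_le _ _).trans (hp₂₃ hR)))
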